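/- **System CFC.** *Syntax.* Pretypes are $\tau,\sigma,\rho ::= H\,\overline\tau \mid \tau_1\to\tau_2 \mid \alpha \mid \forall\alpha.\tau \mid \phi\Rightarrow\tau \mid F\,\overline\tau$, with propositions $\phi ::= \tau_1\sim\tau_2$; type constants $H$ and type families $F$ have arities and are always fully applied. An evaluation assumption is $\chi=(\alpha\mid c: F\,\overline\tau\sim\alpha)$; it binds the type variable $\alpha$ and the coercion variable $c$ in what follows it. An evaluation resolution is $q=(\tau\mid\gamma)$, and $q/\chi$ is the substitution $\tau/\alpha,\gamma/c$. Coercions are $$\gamma,\eta ::= \langle\tau\rangle \mid \mathsf{sym}\,\gamma \mid \gamma_1;\gamma_2 \mid H\,\overline\gamma \mid \gamma_1\to\gamma_2 \mid \forall\alpha.\gamma \mid \gamma_1\sim\gamma_2\Rightarrow\gamma_3 \mid F\,\overline\gamma \mid \mathsf{nth}_i\,\gamma \mid \gamma@\tau \mid c \mid \xi_i\,\overline\tau\,\overline q ,$$ expressions are $$e ::= x \mid K \mid \lambda x{:}\tau.e \mid e_1\,e_2 \mid \Lambda\alpha.e \mid e\,\tau \mid \lambda c{:}\phi.e \mid e\,\gamma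 \mid e\triangleright\gamma \mid \mathsf{assume}\ \chi\ \mathsf{in}\ e ,$$ and values are $v ::= K \mid \lambda x{:}\tau.e \mid \Lambda\alpha.e \mid \lambda c{:}\phi.e$. Everything is taken up to renaming of bound variables. A signature $\Sigma$ is a list of declarations of partial families $F:_{\not\top}n$, of total families $F:_\top n$, and of axioms $\xi:\overline E$ with equations $E=\forall\overline\alpha\,\overline\chi.\,F\,\overline\tau\sim\tau_0$; $F:n$ means either sort of family. Each term constant $K$ has a given type $H\,\overline\tau$. Contexts $\Gamma$ are lists of bindings $\alpha$, $c{:}\phi$, $x{:}\tau$. A pretype is *type-family-free* if no $F\,\overline\tau$ occurs anywhere in it. *Types, propositions, contexts.* $\Gamma\vdash\tau\ \mathsf{type}$ is closed under $H\,\overline\tau$ (with $H$ of the right arity), $\to$, variables of $\Gamma$, and $\forall$ (with $\alpha$ added to $\Gamma$), and $\Gamma\vdash\phi\Rightarrow\tau\ \mathsf{type}$ if $\Gamma\vdash\phi\ \mathsf{prop}$ and $\Gamma\vdash\tau\ \mathsf{type}$. $\Gamma\vdash\tau_1\sim\tau_2\ \mathsf{prop}$ if both sides are types, or if $\tau_1=F\,\overline\sigma$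 with $F:n\in\Sigma$, all $n$ arguments $\sigma_i$ are types and $\tau_2$ is a type. $\vdash\Gamma\ \mathsf{ctx}$ if each binding $c{:}\phi$, $x{:}\tau$ has a valid $\phi$, $\tau$ over the preceding bindings. Leaf rules of all judgments require $\vdash\Gamma\ \mathsf{ctx}$. *Unification.* Two lists of pretypes, with variables taken to be disjoint, are apart if they have no (syntactic) unifier. For $E_k=\forall\overline\alpha_k\overline\chi_k.F_k\,\overline\tau_k\sim\tau_{0k}$, $\mathsf{compat}(E_1,E_2)$ holds if $\overline\tau_1,\overline\tau_2$ are apart, or if they have a most general unifier $\theta$ with $\tau_{01}[\theta\circ\mathit{subst}(\overline\chi_1)]=\tau_{02}[\theta\circ\mathit{subst}(\overline\chi_2)]$, where $\mathit{subst}(\emptyset)=\emptyset$ and $\mathit{subst}(\overline\chi,(\alpha\mid c:F\,\overline\tau\sim\alpha))=\mathit{subst}(\overline\chi)\circ(F\,\overline\tau)/\alpha$. $\mathsf{no\_conflict}(\overline E,i,\overline\sigma,j)$ holds if $\overline\tau_j$ and $\overline\tau_i[\overline\sigma/\overline\alpha_i]$ are apart or $\mathsf{compat}(E_i,E_j)$.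 *Coercions.* $\Gamma\vdash\gamma:\tau\sim\sigma$ is given by: reflexivity $\langle\tau\rangle$ at each fully applied pretype over $\Gamma$; symmetry; transitivity; congruence for $H\,\overline\gamma$, $\gamma_1\to\gamma_2$, $F\,\overline\gamma$, $\forall\alpha.\gamma$, $\gamma_1\sim\gamma_2\Rightarrow\gamma_3$; $\mathsf{nth}_i\,\gamma$, which extracts the $i$-th components (counted from $0$) of an equality between two pretypes $H\,\overline\tau\sim H\,\overline\sigma$, between two arrows, or between two qualified pretypes (three components each); $\gamma@\sigma:\tau_1[\sigma/\alpha]\sim\tau_2[\sigma/\alpha]$ if $\Gamma\vdash\gamma:\forall\alpha.\tau_1\sim\forall\alpha.\tau_2$ and $\Gamma\vdash\sigma\ \mathsf{type}$; coercion variables of $\Gamma$; and axioms: if $\xi:\overline E\in\Sigma$, $E_i=\forall\overline\alpha\,\overline\chi.F\,\overline\tau\sim\tau_0$, each $\sigma_j$ satisfies $\Gamma\vdash\sigma_j\ \mathsf{type}$ and is type-family-free, $\Gamma\vdash\overline q:\overline\chi[\overline\sigma/\overline\alpha]$, and $\mathsf{no\_conflict}(\overline E,i,\overline\sigma,j)$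 for all $j<i$, then $\Gamma\vdash\xi_i\,\overline\sigma\,\overline q: F\,\overline\tau[\overline\sigma/\overline\alpha]\sim\tau_0[\overline\sigma/\overline\alpha,\overline q/\overline\chi]$. Here $\Gamma\vdash\emptyset:\emptyset$, and $\Gamma\vdash q,\overline q:\chi,\overline\chi$ for $q=(\sigma\mid\gamma)$, $\chi=(\alpha\mid c:F\,\overline\tau\sim\alpha)$ if $\Gamma\vdash\sigma\ \mathsf{type}$, $\Gamma\vdash\gamma:F\,\overline\tau\sim\sigma$ and $\Gamma\vdash\overline q:\overline\chi[q/\chi]$. *Expressions.* $\Gamma\vdash e:\tau$ has the usual rules for variables, constants, and abstraction and application over expressions, types (the argument being a type) and coercions (type $\phi\Rightarrow\tau$, the argument being a coercion that proves $\phi$); $\Gamma\vdash e\triangleright\gamma:\tau_2$ if $\Gamma\vdash e:\tau_1$, $\Gamma\vdash\gamma:\tau_1\sim\tau_2$, $\Gamma\vdash\tau_2\ \mathsf{type}$; and $\Gamma\vdash\mathsf{assume}\ (\alpha\mid c:F\,\overline\tau\sim\alpha)\ \mathsf{in}\ e:\tau$ if $F:_\top n\in\Sigma$, the $n$ arguments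 $\overline\tau$ are types over $\Gamma$, $\Gamma,\alpha,c{:}F\,\overline\tau\sim\alpha\vdash e:\tau$ and $\alpha\notin\mathit{fv}(\tau)$. *Reduction.* $e\longrightarrow e'$ is closed under $[\cdot]\,e_2$, $[\cdot]\,\tau$, $[\cdot]\,\gamma$, $[\cdot]\triangleright\gamma$ and contains the three $\beta$-rules $(\lambda x{:}\tau.e)\,e_2\longrightarrow e[e_2/x]$, $(\Lambda\alpha.e)\,\tau\longrightarrow e[\tau/\alpha]$, $(\lambda c{:}\phi.e)\,\gamma\longrightarrow e[\gamma/c]$; the push rules $(v\triangleright\gamma)\,e\longrightarrow (v\,(e\triangleright\mathsf{sym}(\mathsf{nth}_0\gamma)))\triangleright\mathsf{nth}_1\gamma$ for $v=\lambda x{:}\tau.e_0$, $(v\triangleright\gamma)\,\tau\longrightarrow (v\,\tau)\triangleright(\gamma@\tau)$ for $v=\Lambda\alpha.e_0$, $(v\triangleright\eta)\,\gamma\longrightarrow (v\,(\mathsf{nth}_0\eta;\gamma;\mathsf{sym}(\mathsf{nth}_1\eta)))\triangleright\mathsf{nth}_2\eta$ for $v=\lambda c{:}\phi.e_0$; $(v\triangleright\gamma_1)\triangleright\gamma_2\longrightarrow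 v\triangleright(\gamma_1;\gamma_2)$ for every value $v$; and $\mathsf{assume}\ \chi\ \mathsf{in}\ e\longrightarrow e[q/\chi]$ whenever $\chi=(\alpha\mid c:F\,\overline\tau\sim\alpha)$ and $F\,\overline\tau\Downarrow q$, that is, $F$ is total, the $\overline\tau$ are closed types and $\emptyset\vdash q:\chi$. *Assumptions on the ambient data.* (1) $\Sigma$ is valid: names are declared once, and for each equation $\forall\overline\alpha\,\overline\chi.F\,\overline\tau\sim\tau_0$ of an axiom, over the preceding declarations, $F:n$ with $n=|\overline\tau|$, the $\overline\tau$ are types over $\overline\alpha$, each $\chi$ is a saturated application of a declared family to types over $\overline\alpha$ and the preceding assumptions, $\tau_0$ is a type over $\overline\alpha,\overline\chi$, and all these types are type-family-free. (2) $\Sigma$ is good: all equations of one axiom are over the same family; $\mathit{fv}(\overline\tau)=\overline\alpha$ for the left-hand side of each equation; if an axiom has more than one equation, no other axiom is over its family; and any two single-equation axioms over the same family are compatible. (3) The type of every constant $K$ is a closed type. (4) (Total type families) For all $F:_\top n\in\Sigma$ and all $\tau_1,\dots,\tau_n$ with $\emptyset\vdash\tau_i\ \mathsf{type}$ there is $q$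 with $\emptyset\vdash q:(\alpha\mid c:F\,\overline\tau\sim\alpha)$. **Theorem (Progress).** Under (1)–(4), if $\emptyset\vdash e:\tau$, then $e$ is a value $v$, or $e$ is a coerced value $v\triangleright\gamma$, or $e\longrightarrow e'$ for some $e'$. -/

import Mathlib

namespace CFC

/-!  Names (type constants, type families, axioms, term constants) are natural numbers.
Variables are de Bruijn indices, with three separate name spaces: type variables, coercion
variables and term variables. -/

/-- Pretypes `H τ̄ | τ₁ → τ₂ | α | ∀ α. τ | (τ₁ ~ τ₂) ⇒ τ | F τ̄`. -/
inductive Ty : Type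
  | con (H : ℕ) (args : List Ty)
  | arrow (dom cod : Ty)
  | var (i : ℕ)
  | all (body : Ty)
  | qual (left right body : Ty)
  | fam (F : ℕ) (args : List Ty)

/-- Extension of a renaming of indices under one binder. -/
def liftRen (r : ℕ → ℕ) : ℕ → ℕ
  | 0 => 0
  | i + 1 => r i + 1

mutual
/-- Renaming of the free type variables of a pretype. -/
def Ty.rename : Ty → (ℕ → ℕ) → Ty
  | .con H ts, r => .con H (Ty.renames ts r)
  | .arrow a b, r => .arrow (a.rename r) (b.rename r)
  | .var i, r => .var (r i)
  | .all t, r => .all (t.rename (liftRen r))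
  | .qual a b t, r => .qual (a.rename r) (b.rename r) (t.rename r)
  | .fam F ts, r => .fam F (Ty.renames ts r)
/-- `Ty.rename` on every entry of a list. -/
def Ty.renames : List Ty → (ℕ → ℕ) → List Ty
  | [], _ => []
  | t :: ts, r => t.rename r :: Ty.renames ts r
end

/-- Weakening by one type variable. -/
def Ty.shift (t : Ty) : Ty := t.rename Nat.succ

/-- The substitution that sends index `0` to `a` and index `i + 1` to `s i`. -/
def scons {A : Type} (a : A) (s : ℕ → A) : ℕ → A
  | 0 => a
  | i + 1 => s i

/-- Extension of a type substitution under a type binder. -/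
def upTy (s : ℕ → Ty) : ℕ → Ty := scons (.var 0) (fun i => (s i).shift)

mutual
/-- Simultaneous capture-avoiding substitution for the type variables of a pretype. -/
def Ty.subst : Ty → (ℕ → Ty) → Ty
  | .con H ts, s => .con H (Ty.substs ts s)
  | .arrow a b, s => .arrow (a.subst s) (b.subst s)
  | .var i, s => s i
  | .all t, s => .all (t.subst (upTy s))
  | .qual a b t, s => .qual (a.subst s) (b.subst s) (t.subst s)
  | .fam F ts, s => .fam F (Ty.substs ts s)
/-- `Ty.subst` on every entry of a list. -/
def Ty.substs : List Ty → (ℕ → Ty) → List Ty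
  | [], _ => []
  | t :: ts, s => t.subst s :: Ty.substs ts s
end

/-- `τ[σ/α]`, where `α` is the innermost type variable of `τ`. -/
def Ty.inst (t u : Ty) : Ty := t.subst (scons u Ty.var)

mutual
/-- The type variable with index `i` occurs free in the pretype. -/
def Ty.Free : Ty → ℕ → Prop
  | .con _ ts, i => Ty.FreeIn ts i
  | .arrow a b, i => a.Free i ∨ b.Free i
  | .var j, i => j = i
  | .all t, i => t.Free (i + 1)
  | .qual a b t, i => a.Free i ∨ b.Free i ∨ t.Free i
  | .fam _ ts, i => Ty.FreeIn ts i
/-- The type variable with index `i` occurs free in some entry of the list. -/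
def Ty.FreeIn : List Ty → ℕ → Prop
  | [], _ => False
  | t :: ts, i => t.Free i ∨ Ty.FreeIn ts i
end

mutual
/-- No type family application occurs anywhere in the pretype. -/
def Ty.FamFree : Ty → Prop
  | .con _ ts => Ty.FamFrees ts
  | .arrow a b => a.FamFree ∧ b.FamFree
  | .var _ => True
  | .all t => t.FamFree
  | .qual a b t => a.FamFree ∧ b.FamFree ∧ t.FamFree
  | .fam _ _ => False
/-- `Ty.FamFree` for every entry of a list. -/
def Ty.FamFrees : List Ty → Prop
  | [] => True
  | t :: ts => t.FamFree ∧ Ty.FamFrees ts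
end

/-- Evaluation assumptions `χ = (α | c : F τ̄ ~ α)`. Such a `χ` binds the type variable `α` and
the coercion variable `c` in whatever follows it, and not in `τ̄`. -/
structure Assump where
  F : ℕ
  args : List Ty

/-- Type family equations `∀ ᾱ χ̄. F τ̄ ~ τ₀`. The `nvars` variables `ᾱ` are the indices
`0, …, nvars - 1` in `lhs` and in the first assumption; each assumption then binds one further
type variable in the assumptions after it and in `rhs`. -/
structure Eqn where
  nvars : ℕ
  assumps : List Assump
  F : ℕ
  lhs : List Ty
  rhs : Ty

/-- Entries of a signature: a partial family with its arity, a total family with its arity, and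
an axiom with its list of equations. -/
inductive Decl : Type
  | partialFam (F n : ℕ)
  | totalFam (F n : ℕ)
  | axm (ξ : ℕ) (eqs : List Eqn)

/-- Signatures `Σ`; the most recent declaration comes first. -/
abbrev Sig := List Decl

/-- `F : n ∈ Σ`, partial or total. -/
def Sig.HasFam (S : Sig) (F n : ℕ) : Prop :=
  Decl.partialFam F n ∈ S ∨ Decl.totalFam F n ∈ S

/-- The ambient constants: the arity of each type constant `H`, and the type `H τ̄` of each term
constant `K` that exists. -/
structure Consts where
  arity : ℕ → ℕ
  conTy : ℕ → Option (ℕ × List Ty)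

/-- Bindings `α`, `c : τ₁ ~ τ₂` and `x : τ`. -/
inductive Bind : Type
  | tv
  | co (left right : Ty)
  | tm (ty : Ty)

/-- Typing contexts; the most recent binding comes first. -/
abbrev Ctx := List Bind

/-- The number of type variables bound by a context. -/
def Ctx.tvs : Ctx → ℕ
  | [] => 0
  | .tv :: G => Ctx.tvs G + 1
  | .co _ _ :: G => Ctx.tvs G
  | .tm _ :: G => Ctx.tvs G

/-- `c : τ₁ ~ τ₂ ∈ Γ`. -/
inductive Ctx.HasCo : Ctx → ℕ → Ty → Ty → Prop
  | here {G a b} : Ctx.HasCo (.co a b :: G) 0 a b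
  | tv {G c a b} : Ctx.HasCo G c a b → Ctx.HasCo (.tv :: G) c a.shift b.shift
  | co {G c a b a' b'} : Ctx.HasCo G c a b → Ctx.HasCo (.co a' b' :: G) (c + 1) a b
  | tm {G c a b t} : Ctx.HasCo G c a b → Ctx.HasCo (.tm t :: G) c a b

/-- `x : τ ∈ Γ`. -/
inductive Ctx.HasTm : Ctx → ℕ → Ty → Prop
  | here {G t} : Ctx.HasTm (.tm t :: G) 0 t
  | tv {G x t} : Ctx.HasTm G x t → Ctx.HasTm (.tv :: G) x t.shift
  | co {G x t a b} : Ctx.HasTm G x t → Ctx.HasTm (.co a b :: G) x t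
  | tm {G x t t'} : Ctx.HasTm G x t → Ctx.HasTm (.tm t' :: G) (x + 1) t

/-- The context `Γ, α, c : F τ̄ ~ α`. -/
def Ctx.push (G : Ctx) (χ : Assump) : Ctx :=
  .co (.fam χ.F (Ty.renames χ.args Nat.succ)) (.var 0) :: .tv :: G

/-- The context `Γ, χ̄`. -/
def Ctx.pushes : Ctx → List Assump → Ctx
  | G, [] => G
  | G, χ :: χs => Ctx.pushes (G.push χ) χs

/-- The context that consists of `n` type variables. -/
def Ctx.ofTvs (n : ℕ) : Ctx := List.replicate n Bind.tv

/-! Type, proposition and context validity. -/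

mutual
/-- `Γ ⊢ τ type`. -/
inductive TyValid (C : Consts) (S : Sig) : Ctx → Ty → Prop
  | con {G H ts} : CtxValid C S G → ts.length = C.arity H → (∀ t ∈ ts, TyValid C S G t) →
      TyValid C S G (.con H ts)
  | arrow {G a b} : TyValid C S G a → TyValid C S G b → TyValid C S G (.arrow a b)
  | var {G i} : CtxValid C S G → i < Ctx.tvs G → TyValid C S G (.var i)
  | all {G t} : TyValid C S (.tv :: G) t → TyValid C S G (.all t)
  | qual {G a b t} : PropValid C S G a b → TyValid C S G t → TyValid C S G (.qual a b t)
/-- `Γ ⊢ τ₁ ~ τ₂ prop`. -/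
inductive PropValid (C : Consts) (S : Sig) : Ctx → Ty → Ty → Prop
  | types {G a b} : TyValid C S G a → TyValid C S G b → PropValid C S G a b
  | family {G F ts b} : S.HasFam F ts.length → (∀ t ∈ ts, TyValid C S G t) → TyValid C S G b →
      PropValid C S G (.fam F ts) b
/-- `⊢ Γ ctx`. -/
inductive CtxValid (C : Consts) (S : Sig) : Ctx → Prop
  | nil : CtxValid C S []
  | tv {G} : CtxValid C S G → CtxValid C S (.tv :: G)
  | co {G a b} : PropValid C S G a b → CtxValid C S (.co a b :: G)
  | tm {G t} : TyValid C S G t → CtxValid C S (.tm t :: G)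
end

mutual
/-- A pretype whose free variables are among the `k` type variables in scope and in which every
type constant and every (declared) type family is fully applied. -/
def Ty.Pre (C : Consts) (S : Sig) : Ty → ℕ → Prop
  | .con H ts, k => ts.length = C.arity H ∧ Ty.Pres C S ts k
  | .arrow a b, k => a.Pre C S k ∧ b.Pre C S k
  | .var i, k => i < k
  | .all t, k => t.Pre C S (k + 1)
  | .qual a b t, k => a.Pre C S k ∧ b.Pre C S k ∧ t.Pre C S k
  | .fam F ts, k => S.HasFam F ts.length ∧ Ty.Pres C S ts k
/-- `Ty.Pre` for every entry of a list. -/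
def Ty.Pres (C : Consts) (S : Sig) : List Ty → ℕ → Prop
  | [], _ => True
  | t :: ts, k => t.Pre C S k ∧ Ty.Pres C S ts k
end

/-! Unification, compatibility and conflicts of equations. The variables of the two lists that
are unified are regarded as disjoint, so a unifier is a pair of substitutions. -/

/-- `(θ₁, θ₂)` unifies `τ̄₁` and `τ̄₂`. -/
def Unifies (θ₁ θ₂ : ℕ → Ty) (ts₁ ts₂ : List Ty) : Prop :=
  Ty.substs ts₁ θ₁ = Ty.substs ts₂ θ₂

/-- `τ̄₁` and `τ̄₂` are apart: they have no unifier. -/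
def Apart (ts₁ ts₂ : List Ty) : Prop := ¬ ∃ θ₁ θ₂, Unifies θ₁ θ₂ ts₁ ts₂

/-- `(θ₁, θ₂)` is a most general unifier of the left-hand sides of two equations. -/
def IsMGU (θ₁ θ₂ : ℕ → Ty) (E₁ E₂ : Eqn) : Prop :=
  Unifies θ₁ θ₂ E₁.lhs E₂.lhs ∧
    ∀ η₁ η₂, Unifies η₁ η₂ E₁.lhs E₂.lhs → ∃ δ : ℕ → Ty,
      (∀ i < E₁.nvars, η₁ i = (θ₁ i).subst δ) ∧ (∀ i < E₂.nvars, η₂ i = (θ₂ i).subst δ)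

/-- The substitution `θ ∘ subst(χ̄)`: it expands each variable that is bound by an assumption
into the type family application that the variable stands for, and acts as `θ` on the others. -/
def expand : (ℕ → Ty) → List Assump → (ℕ → Ty)
  | θ, [] => θ
  | θ, χ :: χs => expand (scons (.fam χ.F (Ty.substs χ.args θ)) θ) χs

/-- `compat(E₁, E₂)`. -/
inductive Compat (E₁ E₂ : Eqn) : Prop
  | coinc (θ₁ θ₂ : ℕ → Ty) : IsMGU θ₁ θ₂ E₁ E₂ →
      E₁.rhs.subst (expand θ₁ E₁.assumps) = E₂.rhs.subst (expand θ₂ E₂.assumps) → Compat E₁ E₂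
  | distinct : Apart E₁.lhs E₂.lhs → Compat E₁ E₂

/-- The substitution `σ̄/ᾱ`. -/
def ofList : List Ty → (ℕ → Ty)
  | [] => Ty.var
  | t :: ts => scons t (ofList ts)

/-- `no_conflict(Ē, i, σ̄, j)`. -/
inductive NoConflict (Es : List Eqn) (i : ℕ) (σs : List Ty) (j : ℕ) : Prop
  | apart {Ei Ej : Eqn} : Es[i]? = some Ei → Es[j]? = some Ej →
      Apart Ej.lhs (Ty.substs Ei.lhs (ofList σs)) → NoConflict Es i σs j
  | compatible {Ei Ej : Eqn} : Es[i]? = some Ei → Es[j]? = some Ej →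
      Compat Ei Ej → NoConflict Es i σs j

/-! Coercions. -/

/-- Coercions `⟨τ⟩ | sym γ | γ₁ ⨾ γ₂ | H γ̄ | γ₁ → γ₂ | ∀ α. γ | γ₁ ~ γ₂ ⇒ γ₃ | F γ̄ | nth i γ |
γ @ τ | c | ξ i τ̄ q̄`, where an evaluation resolution `q = (τ | γ)` is a pair. -/
inductive Co : Type
  | refl (t : Ty)
  | sym (g : Co)
  | trans (g₁ g₂ : Co)
  | con (H : ℕ) (gs : List Co)
  | arrow (g₁ g₂ : Co)
  | all (g : Co)
  | qual (g₁ g₂ g₃ : Co)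
  | fam (F : ℕ) (gs : List Co)
  | nth (i : ℕ) (g : Co)
  | inst (g : Co) (t : Ty)
  | var (c : ℕ)
  | axm (ξ i : ℕ) (σs : List Ty) (qs : List (Ty × Co))

/-- Evaluation resolutions `q = (τ | γ)`. -/
abbrev Res := Ty × Co

mutual
/-- Renaming of type variables (first map) and coercion variables (second map). -/
def Co.rename : Co → (ℕ → ℕ) → (ℕ → ℕ) → Co
  | .refl t, r, _ => .refl (t.rename r)
  | .sym g, r, k => .sym (g.rename r k)
  | .trans g₁ g₂, r, k => .trans (g₁.rename r k) (g₂.rename r k)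
  | .con H gs, r, k => .con H (Co.renames gs r k)
  | .arrow g₁ g₂, r, k => .arrow (g₁.rename r k) (g₂.rename r k)
  | .all g, r, k => .all (g.rename (liftRen r) k)
  | .qual g₁ g₂ g₃, r, k => .qual (g₁.rename r k) (g₂.rename r k) (g₃.rename r k)
  | .fam F gs, r, k => .fam F (Co.renames gs r k)
  | .nth i g, r, k => .nth i (g.rename r k)
  | .inst g t, r, k => .inst (g.rename r k) (t.rename r)
  | .var c, _, k => .var (k c)
  | .axm ξ i σs qs, r, k => .axm ξ i (Ty.renames σs r) (Co.renameRes qs r k)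
/-- `Co.rename` on every entry of a list. -/
def Co.renames : List Co → (ℕ → ℕ) → (ℕ → ℕ) → List Co
  | [], _, _ => []
  | g :: gs, r, k => g.rename r k :: Co.renames gs r k
/-- Renaming in a list of resolutions. -/
def Co.renameRes : List (Ty × Co) → (ℕ → ℕ) → (ℕ → ℕ) → List (Ty × Co)
  | [], _, _ => []
  | (t, g) :: qs, r, k => (t.rename r, g.rename r k) :: Co.renameRes qs r k
end

mutual
/-- Simultaneous substitution for type variables (first map) and coercion variables (second map). -/
def Co.subst : Co → (ℕ → Ty) → (ℕ → Co) → Co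
  | .refl t, s, _ => .refl (t.subst s)
  | .sym g, s, k => .sym (g.subst s k)
  | .trans g₁ g₂, s, k => .trans (g₁.subst s k) (g₂.subst s k)
  | .con H gs, s, k => .con H (Co.substs gs s k)
  | .arrow g₁ g₂, s, k => .arrow (g₁.subst s k) (g₂.subst s k)
  | .all g, s, k => .all (g.subst (upTy s) (fun c => (k c).rename Nat.succ id))
  | .qual g₁ g₂ g₃, s, k => .qual (g₁.subst s k) (g₂.subst s k) (g₃.subst s k)
  | .fam F gs, s, k => .fam F (Co.substs gs s k)
  | .nth i g, s, k => .nth i (g.subst s k)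
  | .inst g t, s, k => .inst (g.subst s k) (t.subst s)
  | .var c, _, k => k c
  | .axm ξ i σs qs, s, k => .axm ξ i (Ty.substs σs s) (Co.substRes qs s k)
/-- `Co.subst` on every entry of a list. -/
def Co.substs : List Co → (ℕ → Ty) → (ℕ → Co) → List Co
  | [], _, _ => []
  | g :: gs, s, k => g.subst s k :: Co.substs gs s k
/-- Substitution in a list of resolutions. -/
def Co.substRes : List (Ty × Co) → (ℕ → Ty) → (ℕ → Co) → List (Ty × Co)
  | [], _, _ => []
  | (t, g) :: qs, s, k => (t.subst s, g.subst s k) :: Co.substRes qs s k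
end

/-- Type substitution in a list of evaluation assumptions, each of which binds a type variable
in the ones after it. -/
def Assump.substs : List Assump → (ℕ → Ty) → List Assump
  | [], _ => []
  | χ :: χs, s => ⟨χ.F, Ty.substs χ.args s⟩ :: Assump.substs χs (upTy s)

/-- The type part of the substitution `θ, q̄/χ̄`. -/
def withRes : (ℕ → Ty) → List Res → (ℕ → Ty)
  | θ, [] => θ
  | θ, q :: qs => withRes (scons q.1 θ) qs

mutual
/-- `Γ ⊢ γ : τ₁ ~ τ₂`. -/
inductive CoValid (C : Consts) (S : Sig) : Ctx → Co → Ty → Ty → Prop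
  | refl {G t} : CtxValid C S G → t.Pre C S (Ctx.tvs G) → CoValid C S G (.refl t) t t
  | sym {G g a b} : CoValid C S G g a b → CoValid C S G (.sym g) b a
  | trans {G g₁ g₂ a b c} : CoValid C S G g₁ a b → CoValid C S G g₂ b c →
      CoValid C S G (.trans g₁ g₂) a c
  | con {G H gs ts us} : gs.length = C.arity H → CoValids C S G gs ts us →
      CoValid C S G (.con H gs) (.con H ts) (.con H us)
  | arrow {G g₁ g₂ a₁ a₂ b₁ b₂} : CoValid C S G g₁ a₁ b₁ → CoValid C S G g₂ a₂ b₂ →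
      CoValid C S G (.arrow g₁ g₂) (.arrow a₁ a₂) (.arrow b₁ b₂)
  | fam {G F gs ts us} : S.HasFam F gs.length → CoValids C S G gs ts us →
      CoValid C S G (.fam F gs) (.fam F ts) (.fam F us)
  | all {G g a b} : CoValid C S (.tv :: G) g a b → CoValid C S G (.all g) (.all a) (.all b)
  | qual {G g₁ g₂ g₃ a₁ a₂ a₃ b₁ b₂ b₃} : CoValid C S G g₁ a₁ b₁ → CoValid C S G g₂ a₂ b₂ →
      CoValid C S G g₃ a₃ b₃ →
      CoValid C S G (.qual g₁ g₂ g₃) (.qual a₁ a₂ a₃) (.qual b₁ b₂ b₃)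
  | nth {G i g H ts us t u} : CoValid C S G g (.con H ts) (.con H us) →
      ts[i]? = some t → us[i]? = some u → CoValid C S G (.nth i g) t u
  | nthArrow {G i g a₀ a₁ b₀ b₁ t u} : CoValid C S G g (.arrow a₀ a₁) (.arrow b₀ b₁) →
      [a₀, a₁][i]? = some t → [b₀, b₁][i]? = some u → CoValid C S G (.nth i g) t u
  | nthQual {G i g a₀ a₁ a₂ b₀ b₁ b₂ t u} :
      CoValid C S G g (.qual a₀ a₁ a₂) (.qual b₀ b₁ b₂) →
      [a₀, a₁, a₂][i]? = some t → [b₀, b₁, b₂][i]? = some u → CoValid C S G (.nth i g) t u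
  | inst {G g a b t} : CoValid C S G g (.all a) (.all b) → TyValid C S G t →
      CoValid C S G (.inst g t) (a.inst t) (b.inst t)
  | var {G c a b} : CtxValid C S G → Ctx.HasCo G c a b → CoValid C S G (.var c) a b
  /-- The types `σ̄` that instantiate an equation are proper and free of type families. -/
  | axm {G ξ Es i E σs qs} : Decl.axm ξ Es ∈ S → CtxValid C S G → Es[i]? = some E →
      σs.length = E.nvars → (∀ t ∈ σs, TyValid C S G t ∧ t.FamFree) →
      ResValid C S G qs (Assump.substs E.assumps (ofList σs)) →
      (∀ j < i, NoConflict Es i σs j) →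
      CoValid C S G (.axm ξ i σs qs) (.fam E.F (Ty.substs E.lhs (ofList σs)))
        (E.rhs.subst (withRes (ofList σs) qs))
/-- `Γ ⊢ γⱼ : τⱼ ~ σⱼ` for each `j`, the three lists being of equal length. -/
inductive CoValids (C : Consts) (S : Sig) : Ctx → List Co → List Ty → List Ty → Prop
  | nil {G} : CtxValid C S G → CoValids C S G [] [] []
  | cons {G g gs t ts u us} : CoValid C S G g t u → CoValids C S G gs ts us →
      CoValids C S G (g :: gs) (t :: ts) (u :: us)
/-- `Γ ⊢ q̄ : χ̄`. -/
inductive ResValid (C : Consts) (S : Sig) : Ctx → List Res → List Assump → Prop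
  | nil {G} : CtxValid C S G → ResValid C S G [] []
  | cons {G t g qs χ χs} : TyValid C S G t → CoValid C S G g (.fam χ.F χ.args) t →
      ResValid C S G qs (Assump.substs χs (scons t Ty.var)) →
      ResValid C S G ((t, g) :: qs) (χ :: χs)
end

/-! Signature validity. -/

/-- `Γ ⊢ χ̄ assumps`. -/
inductive AssumpsValid (C : Consts) (S : Sig) : Ctx → List Assump → Prop
  | nil {G} : CtxValid C S G → AssumpsValid C S G []
  | cons {G χ χs} : S.HasFam χ.F χ.args.length →
      (∀ t ∈ χ.args, TyValid C S G t ∧ t.FamFree) →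
      AssumpsValid C S (G.push χ) χs → AssumpsValid C S G (χ :: χs)

/-- Validity of one equation: all of its types are proper and free of type families. -/
structure EqnValid (C : Consts) (S : Sig) (E : Eqn) : Prop where
  fam : S.HasFam E.F E.lhs.length
  lhs : ∀ t ∈ E.lhs, TyValid C S (Ctx.ofTvs E.nvars) t ∧ t.FamFree
  assumps : AssumpsValid C S (Ctx.ofTvs E.nvars) E.assumps
  rhs : TyValid C S (Ctx.pushes (Ctx.ofTvs E.nvars) E.assumps) E.rhs ∧ E.rhs.FamFree

/-- `⊢ Σ ok`. -/
inductive SigValid (C : Consts) : Sig → Prop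
  | nil : SigValid C []
  | partialFam {S F n} : SigValid C S → (∀ m, ¬ Sig.HasFam S F m) →
      SigValid C (.partialFam F n :: S)
  | totalFam {S F n} : SigValid C S → (∀ m, ¬ Sig.HasFam S F m) →
      SigValid C (.totalFam F n :: S)
  | axm {S ξ Es} : SigValid C S → (∀ Es', Decl.axm ξ Es' ∉ S) → (∀ E ∈ Es, EqnValid C S E) →
      SigValid C (.axm ξ Es :: S)

/-- The syntactic conditions on a good signature. -/
structure GoodSig (S : Sig) : Prop where
  sameFam : ∀ ξ Es, Decl.axm ξ Es ∈ S → ∃ F, ∀ E ∈ Es, E.F = F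
  freeVars : ∀ ξ Es, Decl.axm ξ Es ∈ S → ∀ E ∈ Es, ∀ i, Ty.FreeIn E.lhs i ↔ i < E.nvars
  closed : ∀ ξ Es, Decl.axm ξ Es ∈ S → 1 < Es.length →
    ∀ ξ' Es', Decl.axm ξ' Es' ∈ S → ξ' ≠ ξ → ∀ E ∈ Es, ∀ E' ∈ Es', E'.F ≠ E.F
  opened : ∀ ξ₁ E₁ ξ₂ E₂, Decl.axm ξ₁ [E₁] ∈ S → Decl.axm ξ₂ [E₂] ∈ S → E₁.F = E₂.F →
    Compat E₁ E₂

/-- The type of every term constant is a proper type. -/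
def ConstsValid (C : Consts) (S : Sig) : Prop :=
  ∀ K H ts, C.conTy K = some (H, ts) → TyValid C S [] (.con H ts)

/-- `F τ̄ ⇓ q`, for a total type family `F` applied to closed proper types: `q` consists of a
proper type and of a closed coercion from `F τ̄` to that type. -/
def Evaluates (C : Consts) (S : Sig) (F : ℕ) (ts : List Ty) (q : Res) : Prop :=
  Decl.totalFam F ts.length ∈ S ∧ (∀ t ∈ ts, TyValid C S [] t) ∧ ResValid C S [] [q] [⟨F, ts⟩]

/-- Total type families: an application of a total family to closed proper types evaluates. -/
def TotalFamilies (C : Consts) (S : Sig) : Prop :=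
  ∀ F n, Decl.totalFam F n ∈ S → ∀ ts : List Ty, ts.length = n → (∀ t ∈ ts, TyValid C S [] t) →
    ∃ q : Res, ResValid C S [] [q] [⟨F, ts⟩]

/-! Expressions. -/

/-- Expressions `x | K | λ x:τ. e | e₁ e₂ | Λ α. e | e τ | λ c:φ. e | e γ | e ▷ γ |
assume χ in e`. -/
inductive Tm : Type
  | var (x : ℕ)
  | con (K : ℕ)
  | lam (t : Ty) (e : Tm)
  | app (e₁ e₂ : Tm)
  | tlam (e : Tm)
  | tapp (e : Tm) (t : Ty)
  | clam (left right : Ty) (e : Tm)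
  | capp (e : Tm) (g : Co)
  | cast (e : Tm) (g : Co)
  | assume (χ : Assump) (e : Tm)

/-- Renaming of type, coercion and term variables, in this order. -/
def Tm.rename : Tm → (ℕ → ℕ) → (ℕ → ℕ) → (ℕ → ℕ) → Tm
  | .var x, _, _, m => .var (m x)
  | .con K, _, _, _ => .con K
  | .lam t e, r, k, m => .lam (t.rename r) (e.rename r k (liftRen m))
  | .app e₁ e₂, r, k, m => .app (e₁.rename r k m) (e₂.rename r k m)
  | .tlam e, r, k, m => .tlam (e.rename (liftRen r) k m)
  | .tapp e t, r, k, m => .tapp (e.rename r k m) (t.rename r)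
  | .clam a b e, r, k, m => .clam (a.rename r) (b.rename r) (e.rename r (liftRen k) m)
  | .capp e g, r, k, m => .capp (e.rename r k m) (g.rename r k)
  | .cast e g, r, k, m => .cast (e.rename r k m) (g.rename r k)
  | .assume χ e, r, k, m =>
      .assume ⟨χ.F, Ty.renames χ.args r⟩ (e.rename (liftRen r) (liftRen k) m)

/-- Simultaneous substitution for type, coercion and term variables, in this order. -/
def Tm.subst : Tm → (ℕ → Ty) → (ℕ → Co) → (ℕ → Tm) → Tm
  | .var x, _, _, u => u x
  | .con K, _, _, _ => .con K
  | .lam t e, s, k, u =>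
      .lam (t.subst s) (e.subst s k (scons (.var 0) (fun x => (u x).rename id id Nat.succ)))
  | .app e₁ e₂, s, k, u => .app (e₁.subst s k u) (e₂.subst s k u)
  | .tlam e, s, k, u =>
      .tlam (e.subst (upTy s) (fun c => (k c).rename Nat.succ id)
        (fun x => (u x).rename Nat.succ id id))
  | .tapp e t, s, k, u => .tapp (e.subst s k u) (t.subst s)
  | .clam a b e, s, k, u =>
      .clam (a.subst s) (b.subst s)
        (e.subst s (scons (.var 0) (fun c => (k c).rename id Nat.succ))
          (fun x => (u x).rename id Nat.succ id))
  | .capp e g, s, k, u => .capp (e.subst s k u) (g.subst s k)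
  | .cast e g, s, k, u => .cast (e.subst s k u) (g.subst s k)
  | .assume χ e, s, k, u =>
      .assume ⟨χ.F, Ty.substs χ.args s⟩
        (e.subst (upTy s) (scons (.var 0) (fun c => (k c).rename Nat.succ Nat.succ))
          (fun x => (u x).rename Nat.succ Nat.succ id))

/-- Values `K | λ x:τ. e | Λ α. e | λ c:φ. e`. -/
inductive Tm.IsValue : Tm → Prop
  | con (K) : Tm.IsValue (.con K)
  | lam (t e) : Tm.IsValue (.lam t e)
  | tlam (e) : Tm.IsValue (.tlam e)
  | clam (a b e) : Tm.IsValue (.clam a b e)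

/-- `Γ ⊢ e : τ`. -/
inductive HasType (C : Consts) (S : Sig) : Ctx → Tm → Ty → Prop
  | var {G x t} : CtxValid C S G → Ctx.HasTm G x t → HasType C S G (.var x) t
  | con {G K H ts} : CtxValid C S G → C.conTy K = some (H, ts) →
      HasType C S G (.con K) (.con H ts)
  | lam {G t e u} : HasType C S (.tm t :: G) e u → HasType C S G (.lam t e) (.arrow t u)
  | tlam {G e t} : HasType C S (.tv :: G) e t → HasType C S G (.tlam e) (.all t)
  | clam {G a b e t} : HasType C S (.co a b :: G) e t →
      HasType C S G (.clam a b e) (.qual a b t)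
  | app {G e₁ e₂ t u} : HasType C S G e₁ (.arrow t u) → HasType C S G e₂ t →
      HasType C S G (.app e₁ e₂) u
  | tapp {G e t u} : HasType C S G e (.all t) → TyValid C S G u →
      HasType C S G (.tapp e u) (t.inst u)
  | capp {G e g a b t} : HasType C S G e (.qual a b t) → CoValid C S G g a b →
      HasType C S G (.capp e g) t
  | cast {G e g t u} : HasType C S G e t → CoValid C S G g t u → TyValid C S G u →
      HasType C S G (.cast e g) u
  /-- The bound type variable does not occur in the type of the body: that type is a weakening. -/
  | assume {G χ e t} : Decl.totalFam χ.F χ.args.length ∈ S → (∀ u ∈ χ.args, TyValid C S G u) →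
      HasType C S (G.push χ) e t.shift → HasType C S G (.assume χ e) t

/-- `e ⟶ e'`. -/
inductive Step (C : Consts) (S : Sig) : Tm → Tm → Prop
  | app {e₁ e₁' e₂} : Step C S e₁ e₁' → Step C S (.app e₁ e₂) (.app e₁' e₂)
  | tapp {e e' t} : Step C S e e' → Step C S (.tapp e t) (.tapp e' t)
  | capp {e e' g} : Step C S e e' → Step C S (.capp e g) (.capp e' g)
  | cast {e e' g} : Step C S e e' → Step C S (.cast e g) (.cast e' g)
  | beta {t e₁ e₂} :
      Step C S (.app (.lam t e₁) e₂) (e₁.subst Ty.var Co.var (scons e₂ Tm.var))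
  | tbeta {e t} : Step C S (.tapp (.tlam e) t) (e.subst (scons t Ty.var) Co.var Tm.var)
  | cbeta {a b e g} : Step C S (.capp (.clam a b e) g) (e.subst Ty.var (scons g Co.var) Tm.var)
  | push {t e₀ g e} :
      Step C S (.app (.cast (.lam t e₀) g) e)
        (.cast (.app (.lam t e₀) (.cast e (.sym (.nth 0 g)))) (.nth 1 g))
  | tpush {e₀ g t} :
      Step C S (.tapp (.cast (.tlam e₀) g) t) (.cast (.tapp (.tlam e₀) t) (.inst g t))
  | cpush {a b e₀ h g} :
      Step C S (.capp (.cast (.clam a b e₀) h) g)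
        (.cast (.capp (.clam a b e₀) (.trans (.trans (.nth 0 h) g) (.sym (.nth 1 h))))
          (.nth 2 h))
  | trans {v g₁ g₂} : v.IsValue →
      Step C S (.cast (.cast v g₁) g₂) (.cast v (.trans g₁ g₂))
  | resolve {χ e q} : Evaluates C S χ.F χ.args q →
      Step C S (.assume χ e) (e.subst (scons q.1 Ty.var) (scons q.2 Co.var) Tm.var)

end CFC

namespace CFC

/-! ### Structural lemmas on pretypes -/

-- Progress reduces to consistency: a closed coercion between two types with concrete heads equates
-- only equal heads. If a coerced value stands in function position, the type of the value then has
-- the same head as the target of the coercion, so the value is the abstraction that the push rule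
-- expects. For an `assume`, the step comes from the assumption on total families.
--
-- Consistency is proved by normal forms. `Red` evaluates a family application at its root: families
-- inside the arguments are inert, and each assumption of the equation must be resolved by a further
-- derivation. Derivations are finite and an application without one stays stuck, so no termination
-- property of the families is needed. `Ty.nf` evaluates all applications from the inside out and
-- keeps every other constructor. `CoValid.nf_eq` shows that closed coercions preserve normal forms.
-- The essential cases are axioms, where `Red` fires, and the instantiation of a quantified
-- equality, which rests on `Ty.nf_nf`.
--
-- Normal forms are useful because `Red` is deterministic (`Red.unique`). Two equations that match
-- the same arguments are compatible: within one axiom by `NoConflict`, across axioms by goodness of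
-- the signature. Compatibility equates the right-hand sides only after each assumed variable is
-- expanded to its family application, at a most general unifier. That unifier is family-free
-- (`IsMGU.famFree`), so the only families to evaluate in the expanded sides are those of the
-- assumptions. Both results are therefore complete evaluations of one pretype (`rhs_eq_of_expand`),
-- and they agree by induction on one of the two derivations.

@[elab_as_elim]
theorem Ty.induct {motive : Ty → Prop}
    (con : ∀ H ts, (∀ t ∈ ts, motive t) → motive (.con H ts))
    (arrow : ∀ a b, motive a → motive b → motive (.arrow a b))
    (var : ∀ i, motive (.var i))
    (all : ∀ t, motive t → motive (.all t))
    (qual : ∀ a b t, motive a → motive b → motive t → motive (.qual a b t))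
    (fam : ∀ F ts, (∀ t ∈ ts, motive t) → motive (.fam F ts)) (t : Ty) : motive t :=
  Ty.rec (motive_1 := motive) (motive_2 := fun ts => ∀ t ∈ ts, motive t)
    con arrow var all qual fam (by simp)
    (fun t ts ht hts => by simpa using ⟨ht, hts⟩) t

@[simp] theorem Ty.renames_eq_map (ts : List Ty) (r : ℕ → ℕ) :
    Ty.renames ts r = ts.map (fun t => t.rename r) := by
  induction ts <;> simp_all [Ty.renames]

@[simp] theorem Ty.substs_eq_map (ts : List Ty) (s : ℕ → Ty) :
    Ty.substs ts s = ts.map (fun t => t.subst s) := by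
  induction ts <;> simp_all [Ty.substs]

@[simp] theorem Ty.famFrees_iff (ts : List Ty) : Ty.FamFrees ts ↔ ∀ t ∈ ts, t.FamFree := by
  induction ts <;> simp_all [Ty.FamFrees]

@[simp] theorem Ty.freeIn_iff (ts : List Ty) (i : ℕ) :
    Ty.FreeIn ts i ↔ ∃ t ∈ ts, t.Free i := by
  induction ts <;> simp_all [Ty.FreeIn]

theorem comp_scons {A B : Type} (f : A → B) (a : A) (s : ℕ → A) :
    (fun i => f (scons a s i)) = scons (f a) (fun i => f (s i)) := by
  funext i; cases i <;> rfl

theorem liftRen_comp (r r' : ℕ → ℕ) :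
    (fun i => liftRen r' (liftRen r i)) = liftRen (fun i => r' (r i)) := by
  funext i; cases i <;> rfl

theorem upTy_comp_liftRen (s : ℕ → Ty) (r : ℕ → ℕ) :
    (fun i => upTy s (liftRen r i)) = upTy (fun i => s (r i)) := by
  funext i; cases i <;> rfl

theorem upTy_var : upTy Ty.var = Ty.var := by
  funext i; cases i <;> simp [upTy, scons, Ty.shift, Ty.rename]

theorem Ty.rename_rename (t : Ty) (r r' : ℕ → ℕ) :
    (t.rename r).rename r' = t.rename (fun i => r' (r i)) := by
  induction t using Ty.induct generalizing r r' <;>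
    simp_all [Ty.rename, liftRen_comp]

theorem Ty.subst_rename (t : Ty) (r : ℕ → ℕ) (s : ℕ → Ty) :
    (t.rename r).subst s = t.subst (fun i => s (r i)) := by
  induction t using Ty.induct generalizing r s <;>
    simp_all [Ty.rename, Ty.subst, upTy_comp_liftRen]

theorem Ty.shift_rename (t : Ty) (r : ℕ → ℕ) :
    t.shift.rename (liftRen r) = (t.rename r).shift := by
  simp [Ty.shift, Ty.rename_rename, liftRen]

theorem rename_upTy (s : ℕ → Ty) (r : ℕ → ℕ) :
    (fun i => (upTy s i).rename (liftRen r)) = upTy (fun i => (s i).rename r) := by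
  funext i
  cases i
  · rfl
  · exact Ty.shift_rename _ _

theorem Ty.rename_subst (t : Ty) (s : ℕ → Ty) (r : ℕ → ℕ) :
    (t.subst s).rename r = t.subst (fun i => (s i).rename r) := by
  induction t using Ty.induct generalizing r s <;>
    simp_all [Ty.rename, Ty.subst, rename_upTy]

theorem Ty.shift_subst (t : Ty) (s : ℕ → Ty) :
    t.shift.subst (upTy s) = (t.subst s).shift := by
  simp [Ty.shift, Ty.subst_rename, Ty.rename_subst, upTy, scons]

theorem subst_upTy (s s' : ℕ → Ty) :
    (fun i => (upTy s i).subst (upTy s')) = upTy (fun i => (s i).subst s') := by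
  funext i
  cases i
  · rfl
  · exact Ty.shift_subst _ _

theorem Ty.subst_subst (t : Ty) (s s' : ℕ → Ty) :
    (t.subst s).subst s' = t.subst (fun i => (s i).subst s') := by
  induction t using Ty.induct generalizing s s' <;>
    simp_all [Ty.subst, subst_upTy]

@[simp] theorem Ty.subst_var (t : Ty) : t.subst Ty.var = t := by
  induction t using Ty.induct with
  | con H ts ih | fam H ts ih =>
    simp only [Ty.subst, Ty.substs_eq_map]
    rw [List.map_congr_left ih, List.map_id']
  | _ => simp_all [Ty.subst, upTy_var]

theorem Ty.rename_eq_subst (t : Ty) (r : ℕ → ℕ) :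
    t.rename r = t.subst (fun i => .var (r i)) := by
  conv_lhs => rw [← Ty.subst_var (t.rename r), Ty.subst_rename]

theorem Ty.shift_inst (t u : Ty) (s : ℕ → Ty) : t.shift.subst (scons u s) = t.subst s := by
  simp [Ty.shift, Ty.subst_rename, scons]

theorem Ty.shift_injective {t u : Ty} (h : t.shift = u.shift) : t = u := by
  simpa [Ty.shift_inst] using congrArg (fun x => x.subst (scons t Ty.var)) h

theorem upTy_scons (s : ℕ → Ty) (u : Ty) :
    (fun i => (upTy s i).subst (scons u Ty.var)) = scons u s := by
  funext i
  cases i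
  · rfl
  · simp [upTy, scons, Ty.shift_inst]

/-- Since the variables of an equation all occur in its left-hand side, this makes a match determine
the matching substitution. -/
theorem Ty.subst_inj_of_free {t : Ty} {s s' : ℕ → Ty} (h : t.subst s = t.subst s') {i : ℕ}
    (hi : t.Free i) : s i = s' i := by
  induction t using Ty.induct generalizing s s' i with
  | con H ts ih =>
    simp only [Ty.Free, Ty.freeIn_iff, Ty.subst, Ty.substs_eq_map, Ty.con.injEq, true_and,
      List.map_inj_left] at h hi
    obtain ⟨t, ht, hti⟩ := hi
    exact ih t ht (h t ht) hti
  | arrow a b iha ihb =>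
    simp only [Ty.Free, Ty.subst, Ty.arrow.injEq] at h hi
    exact hi.elim (iha h.1) (ihb h.2)
  | var j => simp only [Ty.Free, Ty.subst] at h hi; rwa [← hi]
  | all t ih =>
    simp only [Ty.Free, Ty.subst, Ty.all.injEq] at h hi
    exact Ty.shift_injective (ih h hi)
  | qual a b t iha ihb iht =>
    simp only [Ty.Free, Ty.subst, Ty.qual.injEq] at h hi
    exact hi.elim (iha h.1) (fun hi => hi.elim (ihb h.2.1) (iht h.2.2))
  | fam F ts ih =>
    simp only [Ty.Free, Ty.freeIn_iff, Ty.subst, Ty.substs_eq_map, Ty.fam.injEq, true_and,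
      List.map_inj_left] at h hi
    obtain ⟨t, ht, hti⟩ := hi
    exact ih t ht (h t ht) hti

theorem Ty.FamFree.of_subst {t : Ty} {s : ℕ → Ty} (h : (t.subst s).FamFree) : t.FamFree := by
  induction t using Ty.induct generalizing s with
  | con H ts ih =>
    simp only [Ty.FamFree, Ty.subst, Ty.substs_eq_map, Ty.famFrees_iff, List.mem_map,
      forall_exists_index, and_imp, forall_apply_eq_imp_iff₂] at h ⊢
    exact fun t ht => ih t ht (h t ht)
  | arrow a b iha ihb => exact ⟨iha h.1, ihb h.2⟩
  | var j => trivial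
  | all t ih => exact ih (s := upTy s) h
  | qual a b t iha ihb iht => exact ⟨iha h.1, ihb h.2.1, iht h.2.2⟩
  | fam F ts ih => exact h.elim

theorem ofList_famFree {ts : List Ty} (h : ∀ t ∈ ts, t.FamFree) (i : ℕ) :
    (ofList ts i).FamFree := by
  induction ts generalizing i with
  | nil => trivial
  | cons t ts ih =>
    cases i
    · exact h t (by simp)
    · exact ih (fun u hu => h u (by simp [hu])) _

/-! ### Most general unifiers of family-free patterns are family-free -/

mutual
/-- Replaces each type family by a type constant. -/
def Ty.erase : Ty → Ty
  | .con H ts => .con H (Ty.erases ts)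
  | .arrow a b => .arrow a.erase b.erase
  | .var i => .var i
  | .all t => .all t.erase
  | .qual a b t => .qual a.erase b.erase t.erase
  | .fam F ts => .con F (Ty.erases ts)
/-- `Ty.erase` on every entry of a list. -/
def Ty.erases : List Ty → List Ty
  | [] => []
  | t :: ts => t.erase :: Ty.erases ts
end

@[simp] theorem Ty.erases_eq_map (ts : List Ty) : Ty.erases ts = ts.map Ty.erase := by
  induction ts <;> simp_all [Ty.erases]

theorem Ty.erase_famFree (t : Ty) : t.erase.FamFree := by
  induction t using Ty.induct <;> simp_all [Ty.FamFree, Ty.erase]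

theorem Ty.erase_rename (t : Ty) (r : ℕ → ℕ) : (t.rename r).erase = t.erase.rename r := by
  induction t using Ty.induct generalizing r <;> simp_all [Ty.rename, Ty.erase]

theorem Ty.FamFree.erase_subst {t : Ty} (h : t.FamFree) (s : ℕ → Ty) :
    (t.subst s).erase = t.subst (fun i => (s i).erase) := by
  induction t using Ty.induct generalizing s with
  | all t ih =>
    simp only [Ty.subst, Ty.erase, ih h]
    congr 2
    funext i
    cases i
    · rfl
    · exact Ty.erase_rename _ _
  | _ => simp_all [Ty.FamFree, Ty.subst, Ty.erase]

/-- Erasing families to constants maps any unifier of family-free lists to a unifier. The erased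
unifier factors through the most general one, and an instance can be family-free only if the pretype
itself is. A clash between an erased family and an existing constant is harmless, since only
equalities have to be preserved. -/
theorem IsMGU.famFree {θ₁ θ₂ : ℕ → Ty} {E₁ E₂ : Eqn} (h : IsMGU θ₁ θ₂ E₁ E₂)
    (h₁ : ∀ t ∈ E₁.lhs, t.FamFree) (h₂ : ∀ t ∈ E₂.lhs, t.FamFree) :
    (∀ i < E₁.nvars, (θ₁ i).FamFree) ∧ (∀ i < E₂.nvars, (θ₂ i).FamFree) := by
  have hu : Unifies (fun i => (θ₁ i).erase) (fun i => (θ₂ i).erase) E₁.lhs E₂.lhs := by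
    have hmap := congrArg (List.map Ty.erase) h.1
    simp only [Ty.substs_eq_map, List.map_map] at hmap
    simp only [Unifies, Ty.substs_eq_map]
    rw [← List.map_congr_left fun t ht => (h₁ t ht).erase_subst θ₁,
      ← List.map_congr_left fun t ht => (h₂ t ht).erase_subst θ₂]
    exact hmap
  obtain ⟨δ, hδ₁, hδ₂⟩ := h.2 _ _ hu
  exact ⟨fun i hi => Ty.FamFree.of_subst (hδ₁ i hi ▸ Ty.erase_famFree _),
    fun i hi => Ty.FamFree.of_subst (hδ₂ i hi ▸ Ty.erase_famFree _)⟩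

/-! ### Equations of a valid signature -/

/-- Each assumption has family-free arguments over `n` variables and the preceding assumptions. -/
def AssumpsScoped : ℕ → List Assump → Prop
  | _, [] => True
  | n, χ :: χs => (∀ t ∈ χ.args, t.FamFree ∧ ∀ i, t.Free i → i < n) ∧ AssumpsScoped (n + 1) χs

/-- The types of an equation are family-free, and those after the left-hand side are well scoped. -/
structure Eqn.Scoped (E : Eqn) : Prop where
  lhs : ∀ t ∈ E.lhs, t.FamFree
  assumps : AssumpsScoped E.nvars E.assumps
  rhs_famFree : E.rhs.FamFree
  rhs_free : ∀ i, E.rhs.Free i → i < E.nvars + E.assumps.length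

theorem TyValid.lt_of_free {C : Consts} {S : Sig} {G : Ctx} {t : Ty} (h : TyValid C S G t) :
    ∀ i, t.Free i → i < Ctx.tvs G := by
  refine TyValid.rec (motive_1 := fun G t _ => ∀ i, t.Free i → i < Ctx.tvs G)
    (motive_2 := fun G a b _ => ∀ i, a.Free i ∨ b.Free i → i < Ctx.tvs G)
    (motive_3 := fun _ _ => True) ?_ ?_ ?_ ?_ ?_ ?_ ?_ ?_ ?_ ?_ ?_ h
  · intro G H ts _ _ _ _ ih i hi
    simp only [Ty.Free, Ty.freeIn_iff] at hi
    obtain ⟨t, ht, hti⟩ := hi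
    exact ih t ht i hti
  · intro G a b _ _ iha ihb i hi
    exact hi.elim (iha i) (ihb i)
  · rintro G i _ hi _ j rfl
    exact hi
  · intro G t _ ih i hi
    have := ih (i + 1) hi
    simp only [Ctx.tvs] at this
    omega
  · intro G a b t _ _ ihp iht i hi
    rcases hi with hi | hi | hi
    · exact ihp i (.inl hi)
    · exact ihp i (.inr hi)
    · exact iht i hi
  · intro G a b _ _ iha ihb i hi
    exact hi.elim (iha i) (ihb i)
  · intro G F ts b _ _ _ ih ihb i hi
    simp only [Ty.Free, Ty.freeIn_iff] at hi
    rcases hi with ⟨t, ht, hti⟩ | hi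
    · exact ih t ht i hti
    · exact ihb i hi
  all_goals intros; trivial

theorem AssumpsValid.scoped {C : Consts} {S : Sig} {G : Ctx} {χs : List Assump}
    (h : AssumpsValid C S G χs) : AssumpsScoped (Ctx.tvs G) χs := by
  induction h with
  | nil => trivial
  | cons _ hargs _ ih => exact ⟨fun t ht => ⟨(hargs t ht).2, (hargs t ht).1.lt_of_free⟩, ih⟩

theorem Ctx.tvs_pushes (G : Ctx) (χs : List Assump) :
    Ctx.tvs (G.pushes χs) = Ctx.tvs G + χs.length := by
  induction χs generalizing G with
  | nil => rfl
  | cons χ χs ih => simp only [Ctx.pushes, ih, Ctx.push, Ctx.tvs, List.length_cons]; omega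

theorem Ctx.tvs_ofTvs (n : ℕ) : Ctx.tvs (Ctx.ofTvs n) = n := by
  induction n with
  | zero => rfl
  | succ n ih => exact congrArg Nat.succ ih

theorem EqnValid.scoped {C : Consts} {S : Sig} {E : Eqn} (h : EqnValid C S E) : E.Scoped where
  lhs t ht := (h.lhs t ht).2
  assumps := by simpa [Ctx.tvs_ofTvs] using h.assumps.scoped
  rhs_famFree := h.rhs.2
  rhs_free := by simpa [Ctx.tvs_ofTvs, Ctx.tvs_pushes] using h.rhs.1.lt_of_free

theorem SigValid.scoped {C : Consts} {S : Sig} (h : SigValid C S) {ξ : ℕ} {Es : List Eqn}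
    (hξ : Decl.axm ξ Es ∈ S) : ∀ E ∈ Es, E.Scoped := by
  induction h with
  | nil => simp at hξ
  | partialFam _ _ ih => exact ih (by simpa using hξ)
  | totalFam _ _ ih => exact ih (by simpa using hξ)
  | axm _ _ hE ih =>
    rcases List.mem_cons.1 hξ with h | h
    · cases h
      exact fun E hE' => (hE E hE').scoped
    · exact ih h

theorem SigValid.axm_unique {C : Consts} {S : Sig} (h : SigValid C S) {ξ : ℕ}
    {Es Es' : List Eqn} (hξ : Decl.axm ξ Es ∈ S) (hξ' : Decl.axm ξ Es' ∈ S) : Es = Es' := by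
  induction h with
  | nil => simp at hξ
  | partialFam _ _ ih => exact ih (by simpa using hξ) (by simpa using hξ')
  | totalFam _ _ ih => exact ih (by simpa using hξ) (by simpa using hξ')
  | axm _ hnew _ ih =>
    rcases List.mem_cons.1 hξ with h | h <;> rcases List.mem_cons.1 hξ' with h' | h'
    · cases h; cases h'; rfl
    · cases h; exact (hnew _ h').elim
    · cases h'; exact (hnew _ h).elim
    · exact ih h h'

/-! ### Evaluation of a type family application at its root -/

/-- `ResChain P θ χ̄ θ'`: the substitution `θ` extends to `θ'` by resolutions of the assumptions
`χ̄` in the relation `P`. -/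
inductive ResChain (P : ℕ → List Ty → Ty → Prop) :
    (ℕ → Ty) → List Assump → (ℕ → Ty) → Prop
  | nil (θ) : ResChain P θ [] θ
  | cons {θ θ' χ χs u} : P χ.F (Ty.substs χ.args θ) u → ResChain P (scons u θ) χs θ' →
      ResChain P θ (χ :: χs) θ'

/-- `F τ̄` evaluates to a pretype by an equation of the signature, all type families inside of `τ̄`
being inert. The equation is used at a substitution instance of a family-free instance. -/
inductive Red (S : Sig) : ℕ → List Ty → Ty → Prop
  -- The instance is split into a family-free part `σs`, on which conflicts are checked, and an
  -- arbitrary `η`. Substitution and normalization then act on `η` alone and leave the checks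
  -- intact.
  | mk {ξ Es i E σs η θ'} : Decl.axm ξ Es ∈ S → Es[i]? = some E → (∀ t ∈ σs, t.FamFree) →
      (∀ j < i, NoConflict Es i σs j) →
      ResChain (Red S) (fun k => (ofList σs k).subst η) E.assumps θ' →
      Red S E.F (Ty.substs E.lhs (fun k => (ofList σs k).subst η)) (E.rhs.subst θ')

/-- Maps on pretypes that commute with family-free contexts. -/
def FamFreeHom (h : Ty → Ty) : Prop :=
  ∀ t : Ty, t.FamFree → ∀ s, h (t.subst s) = t.subst (fun i => h (s i))

theorem famFreeHom_subst (s : ℕ → Ty) : FamFreeHom (fun t => t.subst s) :=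
  fun t _ s' => Ty.subst_subst t s' s

theorem FamFreeHom.map_substs {h : Ty → Ty} (hh : FamFreeHom h) {ts : List Ty}
    (hts : ∀ t ∈ ts, t.FamFree) (s : ℕ → Ty) :
    (Ty.substs ts s).map h = Ty.substs ts (fun i => h (s i)) := by
  simp only [Ty.substs_eq_map, List.map_map]
  exact List.map_congr_left fun t ht => hh t (hts t ht) s

theorem ResChain.map {P Q : ℕ → List Ty → Ty → Prop} {h : Ty → Ty} (hh : FamFreeHom h)
    (hPQ : ∀ F ts v, P F ts v → Q F (ts.map h) (h v)) {θ θ' : ℕ → Ty} {χs : List Assump} {n : ℕ}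
    (hχ : AssumpsScoped n χs) (hc : ResChain P θ χs θ') :
    ResChain Q (fun i => h (θ i)) χs (fun i => h (θ' i)) := by
  induction hc generalizing n with
  | nil => exact .nil _
  | @cons _ _ _ _ u hP _ ih =>
    refine .cons (u := h u) ?_ ?_
    · rw [← hh.map_substs fun t ht => (hχ.1 t ht).1]
      exact hPQ _ _ _ hP
    · rw [← comp_scons]
      exact ih hχ.2

/-- Used both for substitutions and, once they are available, for normal forms. The map only
replaces `η`, so the equation, the list `σs` and the conflict checks are reused. -/
theorem Red.map {C : Consts} {S : Sig} (hS : SigValid C S) {h : Ty → Ty} (hh : FamFreeHom h)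
    {F : ℕ} {ts : List Ty} {v : Ty} (hr : Red S F ts v) : Red S F (ts.map h) (h v) := by
  refine Red.rec (motive_1 := fun F ts v _ => Red S F (ts.map h) (h v))
    (motive_2 := fun θ χs θ' _ => ∀ n, AssumpsScoped n χs →
      ResChain (Red S) (fun i => h (θ i)) χs (fun i => h (θ' i))) ?_ ?_ ?_ hr
  · intro ξ Es i E σs η θ' hξ hE hσ hnc _ ih
    have hsc := hS.scoped hξ E (List.mem_of_getElem? hE)
    have hθ : (fun k => h ((ofList σs k).subst η))
        = fun k => (ofList σs k).subst (fun j => h (η j)) :=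
      funext fun k => hh _ (ofList_famFree hσ k) η
    rw [hh.map_substs hsc.lhs, hh _ hsc.rhs_famFree, hθ]
    exact .mk hξ hE hσ hnc (hθ ▸ ih _ hsc.assumps)
  · exact fun θ _ _ => .nil _
  · intro θ θ' χ χs u _ _ ih₁ ih₂ n hχ
    refine .cons (u := h u) ?_ ?_
    · rw [← hh.map_substs fun t ht => (hχ.1 t ht).1]
      exact ih₁
    · rw [← comp_scons]
      exact ih₂ _ hχ.2

/-! ### Complete evaluation as a relation -/

mutual
/-- `t.Evals P δ r`: `r` results from `t` by the substitution `δ` and the evaluation, in `P`, of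
every type family application of `t`. -/
def Ty.Evals (P : ℕ → List Ty → Ty → Prop) : Ty → (ℕ → Ty) → Ty → Prop
  | .con H ts, δ, r => ∃ ts', Ty.Evalss P ts δ ts' ∧ r = .con H ts'
  | .arrow a b, δ, r => ∃ a' b', a.Evals P δ a' ∧ b.Evals P δ b' ∧ r = .arrow a' b'
  | .var i, δ, r => r = δ i
  | .all t, δ, r => ∃ t', t.Evals P (upTy δ) t' ∧ r = .all t'
  | .qual a b t, δ, r =>
      ∃ a' b' t', a.Evals P δ a' ∧ b.Evals P δ b' ∧ t.Evals P δ t' ∧ r = .qual a' b' t'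
  | .fam F ts, δ, r => ∃ ts', Ty.Evalss P ts δ ts' ∧ P F ts' r
/-- `Ty.Evals` on every entry of a list. -/
def Ty.Evalss (P : ℕ → List Ty → Ty → Prop) : List Ty → (ℕ → Ty) → List Ty → Prop
  | [], _, rs => rs = []
  | t :: ts, δ, rs => ∃ r rs', t.Evals P δ r ∧ Ty.Evalss P ts δ rs' ∧ rs = r :: rs'
end

section Evals
variable {P Q : ℕ → List Ty → Ty → Prop}

theorem Ty.evalss_iff (ts : List Ty) (δ : ℕ → Ty) (rs : List Ty) :
    Ty.Evalss P ts δ rs ↔ List.Forall₂ (fun t r => t.Evals P δ r) ts rs := by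
  induction ts generalizing rs with
  | nil => simp [Ty.Evalss]
  | cons t ts ih =>
    simp only [Ty.Evalss, ih, List.forall₂_cons_left_iff]

theorem forall₂_map_map {A B A' B' : Type} {R : A → B → Prop} {R' : A' → B' → Prop} {f : A → A'}
    {g : B → B'} {l : List A} {l' : List B} (h : List.Forall₂ R l l')
    (hR : ∀ a ∈ l, ∀ b, R a b → R' (f a) (g b)) : List.Forall₂ R' (l.map f) (l'.map g) := by
  induction h with
  | nil => exact .nil
  | cons hab _ ih =>
    exact .cons (hR _ (by simp) _ hab) (ih fun a ha => hR a (by simp [ha]))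

theorem forall₂_map_map_same {A B C : Type} {R : B → C → Prop} {f : A → B}
    {g : A → C} {l : List A} (hR : ∀ a ∈ l, R (f a) (g a)) :
    List.Forall₂ R (l.map f) (l.map g) := by
  induction l with
  | nil => exact .nil
  | cons a l ih => exact .cons (hR _ (by simp)) (ih fun a ha => hR a (by simp [ha]))

theorem Ty.Evals.rename_left {t : Ty} {ρ : ℕ → ℕ} {δ : ℕ → Ty} {r : Ty}
    (h : t.Evals P (fun i => δ (ρ i)) r) : (t.rename ρ).Evals P δ r := by
  induction t using Ty.induct generalizing ρ δ r with
  | con H ts ih =>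
    simp only [Ty.Evals, Ty.rename, Ty.evalss_iff, Ty.renames_eq_map] at h ⊢
    obtain ⟨rs, h, rfl⟩ := h
    refine ⟨rs, ?_, rfl⟩
    simpa using forall₂_map_map (R' := fun t r => Ty.Evals P t δ r) (g := id) h
      fun t ht r hr => ih t ht hr
  | arrow a b iha ihb =>
    obtain ⟨a', b', h₁, h₂, rfl⟩ := h
    exact ⟨a', b', iha h₁, ihb h₂, rfl⟩
  | var i => exact h
  | all t ih =>
    obtain ⟨t', h, rfl⟩ := h
    refine ⟨t', ih ?_, rfl⟩
    rwa [upTy_comp_liftRen]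
  | qual a b t iha ihb iht =>
    obtain ⟨a', b', t', h₁, h₂, h₃, rfl⟩ := h
    exact ⟨a', b', t', iha h₁, ihb h₂, iht h₃, rfl⟩
  | fam F ts ih =>
    simp only [Ty.Evals, Ty.rename, Ty.evalss_iff, Ty.renames_eq_map] at h ⊢
    obtain ⟨rs, h, hP⟩ := h
    refine ⟨rs, ?_, hP⟩
    simpa using forall₂_map_map (R' := fun t r => Ty.Evals P t δ r) (g := id) h
      fun t ht r hr => ih t ht hr

theorem Ty.Evals.rename_right (hP : ∀ F ts v ρ, P F ts v →
      P F (ts.map fun t => t.rename ρ) (v.rename ρ))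
    {t : Ty} {δ : ℕ → Ty} {r : Ty} (ρ : ℕ → ℕ) (h : t.Evals P δ r) :
    t.Evals P (fun i => (δ i).rename ρ) (r.rename ρ) := by
  induction t using Ty.induct generalizing ρ δ r with
  | con H ts ih =>
    simp only [Ty.Evals, Ty.evalss_iff] at h ⊢
    obtain ⟨rs, h, rfl⟩ := h
    refine ⟨rs.map fun t => t.rename ρ, ?_, by simp [Ty.rename]⟩
    simpa using forall₂_map_map
      (R' := fun t r => Ty.Evals P t (fun i => (δ i).rename ρ) r) (f := id) h
      fun t ht r hr => ih t ht ρ hr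
  | arrow a b iha ihb =>
    obtain ⟨a', b', h₁, h₂, rfl⟩ := h
    exact ⟨_, _, iha ρ h₁, ihb ρ h₂, rfl⟩
  | var i => exact congrArg (fun t => t.rename ρ) h
  | all t ih =>
    obtain ⟨t', h, rfl⟩ := h
    refine ⟨t'.rename (liftRen ρ), ?_, rfl⟩
    rw [← rename_upTy]
    exact ih _ h
  | qual a b t iha ihb iht =>
    obtain ⟨a', b', t', h₁, h₂, h₃, rfl⟩ := h
    exact ⟨_, _, _, iha ρ h₁, ihb ρ h₂, iht ρ h₃, rfl⟩
  | fam F ts ih =>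
    simp only [Ty.Evals, Ty.evalss_iff] at h ⊢
    obtain ⟨rs, h, hF⟩ := h
    refine ⟨rs.map fun t => t.rename ρ, ?_, hP _ _ _ _ hF⟩
    simpa using forall₂_map_map
      (R' := fun t r => Ty.Evals P t (fun i => (δ i).rename ρ) r) (f := id) h
      fun t ht r hr => ih t ht ρ hr

theorem Ty.FamFree.evals_subst (hP : ∀ F ts v ρ, P F ts v →
      P F (ts.map fun t => t.rename ρ) (v.rename ρ))
    {t : Ty} (ht : t.FamFree) {s s' δ : ℕ → Ty} (h : ∀ i, t.Free i → (s i).Evals P δ (s' i)) :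
    (t.subst s).Evals P δ (t.subst s') := by
  induction t using Ty.induct generalizing s s' δ with
  | con H ts ih =>
    simp only [Ty.FamFree, Ty.famFrees_iff, Ty.Free, Ty.freeIn_iff] at ht h
    simp only [Ty.Evals, Ty.subst, Ty.evalss_iff, Ty.substs_eq_map]
    exact ⟨_, forall₂_map_map_same fun t hm => ih t hm (ht t hm)
      fun i hi => h i ⟨t, hm, hi⟩, rfl⟩
  | arrow a b iha ihb =>
    exact ⟨_, _, iha ht.1 fun i hi => h i (.inl hi), ihb ht.2 fun i hi => h i (.inr hi), rfl⟩
  | var i => exact h i rfl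
  | all t ih =>
    refine ⟨_, ih ht fun i hi => ?_, rfl⟩
    cases i with
    | zero => rfl
    -- Below a binder the evaluation of `s i` is weakened on both sides; this is where closure of
    -- `P` under renaming is needed.
    | succ i => exact Ty.Evals.rename_left ((h i hi).rename_right hP Nat.succ)
  | qual a b t iha ihb iht =>
    exact ⟨_, _, _, iha ht.1 fun i hi => h i (.inl hi),
      ihb ht.2.1 fun i hi => h i (.inr (.inl hi)),
      iht ht.2.2 fun i hi => h i (.inr (.inr hi)), rfl⟩
  | fam F ts ih => exact ht.elim

theorem Ty.FamFree.evals (hP : ∀ F ts v ρ, P F ts v →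
      P F (ts.map fun t => t.rename ρ) (v.rename ρ))
    {t : Ty} (ht : t.FamFree) (δ : ℕ → Ty) : t.Evals P δ (t.subst δ) := by
  simpa using ht.evals_subst hP (s := Ty.var) (s' := δ) (δ := δ) fun i _ => rfl

theorem forall₂_unique {A B : Type} {R R' : A → B → Prop} {l : List A} {l₁ l₂ : List B}
    (h₁ : List.Forall₂ R l l₁) (h₂ : List.Forall₂ R' l l₂)
    (h : ∀ a ∈ l, ∀ b b', R a b → R' a b' → b = b') : l₁ = l₂ := by
  induction h₁ generalizing l₂ with
  | nil => cases h₂; rfl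
  | cons hab _ ih =>
    cases h₂ with
    | cons hab' h₂ =>
      rw [h _ (by simp) _ _ hab hab', ih h₂ fun a ha => h a (by simp [ha])]

/-- Two relations are needed because uniqueness will be known, by induction, for one of two
competing derivations only. -/
theorem Ty.Evals.unique (hPQ : ∀ F ts v v', P F ts v → Q F ts v' → v = v')
    {t : Ty} {δ : ℕ → Ty} {r r' : Ty} (h : t.Evals P δ r) (h' : t.Evals Q δ r') : r = r' := by
  induction t using Ty.induct generalizing δ r r' with
  | con H ts ih =>
    simp only [Ty.Evals, Ty.evalss_iff] at h h'
    obtain ⟨rs, h, rfl⟩ := h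
    obtain ⟨rs', h', rfl⟩ := h'
    rw [forall₂_unique h h' fun t ht _ _ hr hr' => ih t ht hr hr']
  | arrow a b iha ihb =>
    obtain ⟨_, _, h₁, h₂, rfl⟩ := h
    obtain ⟨_, _, h₁', h₂', rfl⟩ := h'
    rw [iha h₁ h₁', ihb h₂ h₂']
  | var i => exact Eq.trans h (Eq.symm h')
  | all t ih =>
    obtain ⟨_, h, rfl⟩ := h
    obtain ⟨_, h', rfl⟩ := h'
    rw [ih h h']
  | qual a b t iha ihb iht =>
    obtain ⟨_, _, _, h₁, h₂, h₃, rfl⟩ := h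
    obtain ⟨_, _, _, h₁', h₂', h₃', rfl⟩ := h'
    rw [iha h₁ h₁', ihb h₂ h₂', iht h₃ h₃']
  | fam F ts ih =>
    simp only [Ty.Evals, Ty.evalss_iff] at h h'
    obtain ⟨rs, h, hF⟩ := h
    obtain ⟨rs', h', hF'⟩ := h'
    cases forall₂_unique h h' fun t ht _ _ hr hr' => ih t ht hr hr'
    exact hPQ _ _ _ _ hF hF'

/-- Resolving assumptions one after another is the same as expanding them to family applications and
evaluating the outcome, because the arguments of each assumption are family-free. -/
theorem ResChain.evals_expand (hP : ∀ F ts v ρ, P F ts v →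
      P F (ts.map fun t => t.rename ρ) (v.rename ρ))
    {θ θ' m δ : ℕ → Ty} {χs : List Assump} {n : ℕ} (hc : ResChain P θ χs θ')
    (hχ : AssumpsScoped n χs) (hm : ∀ i < n, (m i).Evals P δ (θ i)) :
    ∀ i < n + χs.length, (expand m χs i).Evals P δ (θ' i) := by
  induction hc generalizing m n with
  | nil => exact hm
  | cons hF _ ih =>
    rename_i θ θ' χ χs u _
    have := ih (m := scons (.fam χ.F (Ty.substs χ.args m)) m) hχ.2 (fun i hi => ?_)
    · intro i hi
      exact this i (by simp only [List.length_cons] at hi; omega)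
    · cases i with
      | zero =>
        simp only [Ty.substs_eq_map] at hF
        simp only [scons, Ty.Evals, Ty.substs_eq_map, Ty.evalss_iff]
        exact ⟨_, forall₂_map_map_same fun t ht =>
          (hχ.1 t ht).1.evals_subst hP fun i hi => hm i ((hχ.1 t ht).2 i hi), hF⟩
      | succ i => exact hm i (by omega)

end Evals

/-! ### Root evaluation is deterministic -/

/-- `F τ̄` evaluates to `v`, uniquely so after every substitution. -/
def RedUnique (S : Sig) (F : ℕ) (ts : List Ty) (v : Ty) : Prop :=
  -- Quantifying over all substitutions makes this relation closed under renaming, so that it can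
  -- serve as induction hypothesis below binders.
  Red S F ts v ∧ ∀ s v', Red S F (ts.map fun t => t.subst s) v' → v' = v.subst s

theorem RedUnique.subst {C : Consts} {S : Sig} (hS : SigValid C S) {F : ℕ} {ts : List Ty} {v : Ty}
    (h : RedUnique S F ts v) (s : ℕ → Ty) :
    RedUnique S F (ts.map fun t => t.subst s) (v.subst s) := by
  refine ⟨h.1.map hS (famFreeHom_subst s), fun s' v' hv' => ?_⟩
  rw [Ty.subst_subst]
  refine h.2 _ _ ?_
  simpa [Function.comp_def, Ty.subst_subst] using hv'

/-- The right-hand sides of two equations agree after resolution of the assumptions if they agree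
after expansion of the assumptions in a family-free generalization. -/
theorem rhs_eq_of_expand {C : Consts} {S : Sig} (hS : SigValid C S) {E₁ E₂ : Eqn}
    (h₁ : E₁.Scoped) (h₂ : E₂.Scoped) {θ₁ θ₂ θ₁' θ₂' m₁ m₂ δ : ℕ → Ty}
    (hc₁ : ResChain (RedUnique S) θ₁ E₁.assumps θ₁') (hc₂ : ResChain (Red S) θ₂ E₂.assumps θ₂')
    (hm₁ : ∀ i < E₁.nvars, (m₁ i).FamFree ∧ θ₁ i = (m₁ i).subst δ)
    (hm₂ : ∀ i < E₂.nvars, (m₂ i).FamFree ∧ θ₂ i = (m₂ i).subst δ)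
    (he : E₁.rhs.subst (expand m₁ E₁.assumps) = E₂.rhs.subst (expand m₂ E₂.assumps)) :
    E₂.rhs.subst θ₂' = E₁.rhs.subst θ₁' := by
  have hP : ∀ F ts v ρ, RedUnique S F ts v →
      RedUnique S F (ts.map fun t => t.rename ρ) (v.rename ρ) := fun F ts v ρ h => by
    simpa only [Ty.rename_eq_subst] using h.subst hS _
  have hQ : ∀ F ts v ρ, Red S F ts v →
      Red S F (ts.map fun t => t.rename ρ) (v.rename ρ) := fun F ts v ρ h => by
    simpa only [Ty.rename_eq_subst] using h.map hS (famFreeHom_subst _)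
  -- Being family-free, `m₁ i` evaluates to its plain substitution instance, which is `θ₁ i`.
  have e₁ := hc₁.evals_expand hP (m := m₁) (δ := δ) h₁.assumps
    fun i hi => (hm₁ i hi).2 ▸ (hm₁ i hi).1.evals hP δ
  have e₂ := hc₂.evals_expand hQ (m := m₂) (δ := δ) h₂.assumps
    fun i hi => (hm₂ i hi).2 ▸ (hm₂ i hi).1.evals hQ δ
  have r₁ := h₁.rhs_famFree.evals_subst hP fun i hi => e₁ i (h₁.rhs_free i hi)
  have r₂ := h₂.rhs_famFree.evals_subst hQ fun i hi => e₂ i (h₂.rhs_free i hi)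
  -- Now `r₁` and `r₂` are evaluations of one and the same expanded pretype.
  rw [he] at r₁
  refine (r₁.unique (fun F ts v v' hv hv' => ?_) r₂).symm
  simpa using (hv.2 Ty.var v' (by simpa using hv')).symm

theorem Compat.symm {E₁ E₂ : Eqn} (h : Compat E₁ E₂) : Compat E₂ E₁ := by
  cases h with
  | coinc θ₁ θ₂ hm he =>
    refine .coinc θ₂ θ₁ ⟨hm.1.symm, fun η₁ η₂ hu => ?_⟩ he.symm
    obtain ⟨δ, h₁, h₂⟩ := hm.2 η₂ η₁ hu.symm
    exact ⟨δ, h₂, h₁⟩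
  | distinct h => exact .distinct fun ⟨θ₁, θ₂, hu⟩ => h ⟨θ₂, θ₁, hu.symm⟩

/-- The two matching substitutions form a unifier, hence factor through the most general one by a
common `δ`. -/
theorem Compat.rhs_eq {C : Consts} {S : Sig} (hS : SigValid C S) {E₁ E₂ : Eqn}
    (hcompat : Compat E₁ E₂) (h₁ : E₁.Scoped) (h₂ : E₂.Scoped) {θ₁ θ₂ θ₁' θ₂' : ℕ → Ty}
    (hc₁ : ResChain (RedUnique S) θ₁ E₁.assumps θ₁') (hc₂ : ResChain (Red S) θ₂ E₂.assumps θ₂')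
    (hl : Ty.substs E₁.lhs θ₁ = Ty.substs E₂.lhs θ₂) :
    E₂.rhs.subst θ₂' = E₁.rhs.subst θ₁' := by
  cases hcompat with
  | coinc m₁ m₂ hm he =>
    obtain ⟨δ, hδ₁, hδ₂⟩ := hm.2 θ₁ θ₂ hl
    have hf := hm.famFree h₁.lhs h₂.lhs
    exact rhs_eq_of_expand hS h₁ h₂ hc₁ hc₂ (fun i hi => ⟨hf.1 i hi, hδ₁ i hi⟩)
      (fun i hi => ⟨hf.2 i hi, hδ₂ i hi⟩) he
  | distinct h => exact (h ⟨θ₁, θ₂, hl⟩).elim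

/-- The identity plays the role of the unifier, as the left-hand side forces `θ₁` and `θ₂` to agree
on the variables of the equation. -/
theorem Eqn.rhs_eq {C : Consts} {S : Sig} (hS : SigValid C S) {E : Eqn}
    (hfree : ∀ i < E.nvars, Ty.FreeIn E.lhs i) (h : E.Scoped) {θ₁ θ₂ θ₁' θ₂' : ℕ → Ty}
    (hc₁ : ResChain (RedUnique S) θ₁ E.assumps θ₁') (hc₂ : ResChain (Red S) θ₂ E.assumps θ₂')
    (hl : Ty.substs E.lhs θ₁ = Ty.substs E.lhs θ₂) :
    E.rhs.subst θ₂' = E.rhs.subst θ₁' := by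
  refine rhs_eq_of_expand hS h h hc₁ hc₂ (m₁ := Ty.var) (m₂ := Ty.var) (δ := θ₁)
    (fun i _ => ⟨trivial, rfl⟩) (fun i hi => ⟨trivial, ?_⟩) rfl
  obtain ⟨t, ht, hti⟩ := (Ty.freeIn_iff _ _).1 (hfree i hi)
  simp only [Ty.substs_eq_map, List.map_inj_left] at hl
  exact (Ty.subst_inj_of_free (hl t ht) hti).symm

theorem NoConflict.compat_of_unifies {Es : List Eqn} {i j : ℕ} {σs : List Ty} {E₁ E₂ : Eqn}
    (h : NoConflict Es i σs j) (h₁ : Es[i]? = some E₁) (h₂ : Es[j]? = some E₂) {η θ : ℕ → Ty}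
    (hu : Ty.substs E₁.lhs (fun k => (ofList σs k).subst η) = Ty.substs E₂.lhs θ) :
    Compat E₁ E₂ := by
  cases h with
  | apart h₁' h₂' ha =>
    cases h₁.symm.trans h₁'
    cases h₂.symm.trans h₂'
    -- Apartness is refuted with `η` on the side of the `σs`-instance: the two sides of a unifier
    -- are independent substitutions.
    refine (ha ⟨θ, η, ?_⟩).elim
    simpa [Unifies, Function.comp_def, Ty.subst_subst] using hu.symm
  | compatible h₁' h₂' hc =>
    cases h₁.symm.trans h₁'
    cases h₂.symm.trans h₂'
    exact hc

theorem Red.unique_subst {C : Consts} {S : Sig} (hS : SigValid C S) (hgood : GoodSig S)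
    {F : ℕ} {ts : List Ty} {v : Ty} (hr : Red S F ts v) : RedUnique S F ts v := by
  refine Red.rec (motive_1 := fun F ts v _ => RedUnique S F ts v)
    (motive_2 := fun θ χs θ' _ => ResChain (RedUnique S) θ χs θ') ?_ ?_ ?_ hr
  · intro ξ Es i E σs η θ' hξ hE hσ hnc hc ih
    refine ⟨.mk hξ hE hσ hnc hc, fun s v' hr' => ?_⟩
    have hsc := hS.scoped hξ E (List.mem_of_getElem? hE)
    -- The resolutions are moved to the substituted arguments while their uniqueness is kept.
    have hc₁ := ih.map (famFreeHom_subst s) (fun _ _ _ h => h.subst hS s) hsc.assumps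
    rw [(famFreeHom_subst s).map_substs hsc.lhs] at hr'
    simp only [Ty.subst_subst] at hr' hc₁ ⊢
    generalize hF' : E.F = F' at hr'
    generalize hts' : Ty.substs E.lhs _ = ts' at hr'
    cases hr' with
    | @mk ξ₂ Es₂ i₂ E₂ σs₂ η₂ θ₂' hξ₂ hE₂ hσ₂ hnc₂ hc₂ =>
      have hsc₂ := hS.scoped hξ₂ E₂ (List.mem_of_getElem? hE₂)
      have hmem := List.mem_of_getElem? hE
      have hmem₂ := List.mem_of_getElem? hE₂
      by_cases hxi : ξ = ξ₂
      · subst hxi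
        cases hS.axm_unique hξ hξ₂
        -- The use of the later equation carries a conflict check against the earlier one, which
        -- yields compatibility in either order.
        rcases lt_trichotomy i i₂ with hlt | heq | hlt
        · exact ((hnc₂ i hlt).compat_of_unifies hE₂ hE hts'.symm).symm.rhs_eq hS hsc hsc₂
            hc₁ hc₂ hts'
        · subst heq
          cases hE.symm.trans hE₂
          exact Eqn.rhs_eq hS (fun i hi => (hgood.freeVars ξ Es hξ E hmem i).2 hi) hsc
            hc₁ hc₂ hts'
        · exact ((hnc i₂ hlt).compat_of_unifies hE hE₂ hts').rhs_eq hS hsc hsc₂ hc₁ hc₂ hts'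
      -- An axiom with several equations owns its family, so distinct axioms over the same family
      -- both have a single equation.
      · have hlen : Es.length = 1 := by
          by_contra hne
          have := List.length_pos_of_mem hmem
          exact hgood.closed ξ Es hξ (by omega) ξ₂ Es₂ hξ₂ (Ne.symm hxi) E hmem E₂ hmem₂ hF'.symm
        have hlen₂ : Es₂.length = 1 := by
          by_contra hne
          have := List.length_pos_of_mem hmem₂
          exact hgood.closed ξ₂ Es₂ hξ₂ (by omega) ξ Es hξ hxi E₂ hmem₂ E hmem hF'
        obtain ⟨E', rfl⟩ := List.length_eq_one_iff.1 hlen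
        obtain ⟨E₂', rfl⟩ := List.length_eq_one_iff.1 hlen₂
        cases List.mem_singleton.1 hmem
        cases List.mem_singleton.1 hmem₂
        exact (hgood.opened _ _ _ _ hξ hξ₂ hF').rhs_eq hS hsc hsc₂ hc₁ hc₂ hts'
  · exact fun θ => .nil _
  · exact fun h _ ih₁ ih₂ => .cons ih₁ ih₂

theorem Red.unique {C : Consts} {S : Sig} (hS : SigValid C S) (hgood : GoodSig S)
    {F : ℕ} {ts : List Ty} {v v' : Ty} (h : Red S F ts v) (h' : Red S F ts v') : v = v' := by
  simpa using ((h.unique_subst hS hgood).2 Ty.var v' (by simpa using h')).symm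

/-! ### Normal forms -/

open Classical in
/-- The value of `F τ̄`, or `F τ̄` itself if it does not evaluate. -/
noncomputable def evalFam (S : Sig) (F : ℕ) (ts : List Ty) : Ty :=
  if h : ∃ v, Red S F ts v then h.choose else .fam F ts

mutual
/-- The normal form of a pretype whose variables have the normal forms `δ`. -/
noncomputable def Ty.nf (S : Sig) : Ty → (ℕ → Ty) → Ty
  | .con H ts, δ => .con H (Ty.nfs S ts δ)
  | .arrow a b, δ => .arrow (a.nf S δ) (b.nf S δ)
  | .var i, δ => δ i
  | .all t, δ => .all (t.nf S (upTy δ))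
  | .qual a b t, δ => .qual (a.nf S δ) (b.nf S δ) (t.nf S δ)
  | .fam F ts, δ => evalFam S F (Ty.nfs S ts δ)
/-- `Ty.nf` on every entry of a list. -/
noncomputable def Ty.nfs (S : Sig) : List Ty → (ℕ → Ty) → List Ty
  | [], _ => []
  | t :: ts, δ => t.nf S δ :: Ty.nfs S ts δ
end

@[simp] theorem Ty.nfs_eq_map (S : Sig) (ts : List Ty) (δ : ℕ → Ty) :
    Ty.nfs S ts δ = ts.map (fun t => t.nf S δ) := by
  induction ts <;> simp_all [Ty.nfs]

theorem evalFam_spec (S : Sig) (F : ℕ) (ts : List Ty) :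
    Red S F ts (evalFam S F ts) ∨ evalFam S F ts = .fam F ts := by
  unfold evalFam
  split
  · next h => exact .inl h.choose_spec
  · exact .inr rfl

theorem liftRen_injective {r : ℕ → ℕ} (h : Function.Injective r) :
    Function.Injective (liftRen r) := by
  intro i j hij
  cases i <;> cases j <;> simp_all [liftRen, h.eq_iff]

section Normal
variable {C : Consts} {S : Sig} (hS : SigValid C S) (hgood : GoodSig S)
include hS hgood

theorem Red.evalFam_eq {F : ℕ} {ts : List Ty} {v : Ty} (h : Red S F ts v) :
    evalFam S F ts = v := by
  have hex : ∃ v, Red S F ts v := ⟨v, h⟩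
  rw [evalFam, dif_pos hex]
  exact hex.choose_spec.unique hS hgood h

theorem evalFam_rename {r : ℕ → ℕ} (hr : Function.Injective r) (F : ℕ) (ts : List Ty) :
    evalFam S F (ts.map fun t => t.rename r) = (evalFam S F ts).rename r := by
  have ren : ∀ v, Red S F ts v → Red S F (ts.map fun t => t.rename r) (v.rename r) := fun v h => by
    simpa only [Ty.rename_eq_subst] using h.map hS (famFreeHom_subst _)
  by_cases hex : ∃ v, Red S F ts v
  · obtain ⟨v, hv⟩ := hex
    rw [hv.evalFam_eq hS hgood, (ren v hv).evalFam_eq hS hgood]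
  · have hex' : ¬ ∃ v, Red S F (ts.map fun t => t.rename r) v := by
      rintro ⟨v, hv⟩
      -- Injectivity lets an evaluation of the renamed arguments be carried back. Identifying
      -- variables could create a match with a repeated pattern variable.
      obtain ⟨g, hg⟩ := hr.hasLeftInverse
      have := hv.map hS (famFreeHom_subst fun i => Ty.var (g i))
      simp only [List.map_map, Function.comp_def, Ty.subst_rename, hg _, Ty.subst_var,
        List.map_id'] at this
      exact hex ⟨_, this⟩
    rw [evalFam, dif_neg hex', evalFam, dif_neg hex]
    simp [Ty.rename]

omit hS hgood in
theorem Ty.nf_rename (t : Ty) (r : ℕ → ℕ) (δ : ℕ → Ty) :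
    (t.rename r).nf S δ = t.nf S (fun i => δ (r i)) := by
  induction t using Ty.induct generalizing r δ with
  | con H ts ih | fam H ts ih =>
    simp only [Ty.nf, Ty.rename, Ty.nfs_eq_map, Ty.renames_eq_map, List.map_map]
    congr 1
    exact List.map_congr_left fun t ht => ih t ht r δ
  | _ => simp_all [Ty.nf, Ty.rename, upTy_comp_liftRen]

theorem Ty.rename_nf (t : Ty) {r : ℕ → ℕ} (hr : Function.Injective r) (δ : ℕ → Ty) :
    (t.nf S δ).rename r = t.nf S (fun i => (δ i).rename r) := by
  induction t using Ty.induct generalizing r δ with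
  | con H ts ih =>
    simp only [Ty.nf, Ty.rename, Ty.nfs_eq_map, Ty.renames_eq_map, List.map_map]
    congr 1
    exact List.map_congr_left fun t ht => ih t ht hr δ
  | fam H ts ih =>
    simp only [Ty.nf, Ty.nfs_eq_map]
    rw [← evalFam_rename hS hgood hr, List.map_map]
    congr 1
    exact List.map_congr_left fun t ht => ih t ht hr δ
  | all t ih =>
    simp only [Ty.nf, Ty.rename, ih (liftRen_injective hr), rename_upTy]
  | _ => simp_all [Ty.nf, Ty.rename]

theorem nf_upTy (s δ : ℕ → Ty) :
    (fun i => (upTy s i).nf S (upTy δ)) = upTy (fun i => (s i).nf S δ) := by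
  funext i
  cases i with
  | zero => rfl
  | succ i =>
    change ((s i).rename Nat.succ).nf S (upTy δ) = ((s i).nf S δ).rename Nat.succ
    rw [Ty.nf_rename, Ty.rename_nf hS hgood _ Nat.succ_injective]
    rfl

theorem Ty.nf_subst (t : Ty) (s δ : ℕ → Ty) :
    (t.subst s).nf S δ = t.nf S (fun i => (s i).nf S δ) := by
  induction t using Ty.induct generalizing s δ with
  | con H ts ih | fam H ts ih =>
    simp only [Ty.nf, Ty.subst, Ty.nfs_eq_map, Ty.substs_eq_map, List.map_map]
    congr 1
    exact List.map_congr_left fun t ht => ih t ht s δ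
  | all t ih => simp only [Ty.nf, Ty.subst, ih, nf_upTy hS hgood]
  | _ => simp_all [Ty.nf, Ty.subst]

-- Families inside the values of `δ` are not evaluated again, so a family-free pretype only has
-- variables to replace.
omit hS hgood in
theorem Ty.FamFree.nf_eq {t : Ty} (h : t.FamFree) (δ : ℕ → Ty) : t.nf S δ = t.subst δ := by
  induction t using Ty.induct generalizing δ <;> simp_all [Ty.FamFree, Ty.nf, Ty.subst]

theorem famFreeHom_nf (δ : ℕ → Ty) : FamFreeHom (fun t => t.nf S δ) :=
  fun t ht s => (Ty.nf_subst hS hgood t s δ).trans (ht.nf_eq _)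

/-- An application that evaluates keeps doing so after its arguments are normalized further, by
`Red.map`. A stuck one remains in the normal form and gets its second chance in the second pass. -/
theorem Ty.nf_nf (t : Ty) (δ δ' : ℕ → Ty) :
    (t.nf S δ).nf S δ' = t.nf S (fun i => (δ i).nf S δ') := by
  induction t using Ty.induct generalizing δ δ' with
  | con H ts ih =>
    simp only [Ty.nf, Ty.nfs_eq_map, List.map_map]
    congr 1
    exact List.map_congr_left fun t ht => ih t ht δ δ'
  | fam F ts ih =>
    have hargs : (ts.map fun t => t.nf S δ).map (fun t => t.nf S δ')
        = ts.map fun t => t.nf S (fun i => (δ i).nf S δ') := by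
      rw [List.map_map]
      exact List.map_congr_left fun t ht => ih t ht δ δ'
    simp only [Ty.nf, Ty.nfs_eq_map, ← hargs]
    rcases evalFam_spec S F (ts.map fun t => t.nf S δ) with h | h
    · exact ((h.map hS (famFreeHom_nf hS hgood δ')).evalFam_eq hS hgood).symm
    · simp only [h, Ty.nf, Ty.nfs_eq_map]
  | all t ih => simp only [Ty.nf, ih, nf_upTy hS hgood]
  | _ => simp_all [Ty.nf]

/-- The normal form under any `δ` is a function of the normal form under the identity, so
instantiation cannot separate pretypes that have equal normal forms. -/
theorem Ty.nf_inst_congr {a b : Ty} (h : a.nf S Ty.var = b.nf S Ty.var) (t : Ty) :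
    (a.inst t).nf S Ty.var = (b.inst t).nf S Ty.var := by
  have key : ∀ (a : Ty) (δ : ℕ → Ty), a.nf S δ = (a.nf S Ty.var).nf S δ := fun a δ => by
    simp only [Ty.nf_nf hS hgood, Ty.nf]
  simp only [Ty.inst, Ty.nf_subst hS hgood]
  rw [key a, key b, h]

-- Consistency: coercions preserve normal forms

omit hS hgood in
theorem TyValid.nf_ne_fam {G : Ctx} {t : Ty} (h : TyValid C S G t) (F : ℕ) (ts : List Ty) :
    t.nf S Ty.var ≠ .fam F ts := by
  cases h <;> simp [Ty.nf]

omit hS hgood in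
theorem Assump.substs_substs (χs : List Assump) (s s' : ℕ → Ty) :
    Assump.substs (Assump.substs χs s) s' = Assump.substs χs (fun i => (s i).subst s') := by
  induction χs generalizing s s' with
  | nil => rfl
  | cons χ χs ih =>
    simp [Assump.substs, ih, subst_upTy, Function.comp_def, Ty.subst_subst]

/-- Coercions over a context of type variables relate pretypes that have the same normal form. -/
theorem CoValid.nf_eq {G : Ctx} {g : Co} {a b : Ty} (h : CoValid C S G g a b)
    (hG : ∀ x ∈ G, x = Bind.tv) : a.nf S Ty.var = b.nf S Ty.var := by
  revert hG
  refine CoValid.rec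
    (motive_1 := fun G _ a b _ => (∀ x ∈ G, x = Bind.tv) → a.nf S Ty.var = b.nf S Ty.var)
    (motive_2 := fun G _ ts us _ => (∀ x ∈ G, x = Bind.tv) →
      Ty.nfs S ts Ty.var = Ty.nfs S us Ty.var)
    -- `ResValid` substitutes into the remaining assumptions step by step, whereas a chain
    -- accumulates one substitution. Writing `χs` as an instance of the original `χs₀` under `θ`
    -- links the two.
    (motive_3 := fun G qs χs _ => (∀ x ∈ G, x = Bind.tv) → ∀ χs₀ θ n, AssumpsScoped n χs₀ →
      χs = Assump.substs χs₀ θ → ResChain (Red S) (fun i => (θ i).nf S Ty.var) χs₀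
        (fun i => (withRes θ qs i).nf S Ty.var))
    ?refl ?sym ?trans ?con ?arrow ?fam ?all ?qual ?nth ?nthArrow ?nthQual ?inst ?var ?axm
    ?nil ?cons ?rnil ?rcons h
  case refl => intros; rfl
  case sym => intro _ _ _ _ _ ih hG; exact (ih hG).symm
  case trans => intro _ _ _ _ _ _ _ _ ih₁ ih₂ hG; exact (ih₁ hG).trans (ih₂ hG)
  case con => intro _ _ _ _ _ _ _ ih hG; simp only [Ty.nf, ih hG]
  case arrow => intro _ _ _ _ _ _ _ _ _ ih₁ ih₂ hG; simp only [Ty.nf, ih₁ hG, ih₂ hG]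
  case fam => intro _ _ _ _ _ _ _ ih hG; simp only [Ty.nf, ih hG]
  case all =>
    intro G _ a b _ ih hG
    simp only [Ty.nf, upTy_var]
    rw [ih (by simpa using hG)]
  case qual =>
    intro _ _ _ _ _ _ _ _ _ _ _ _ _ ih₁ ih₂ ih₃ hG
    simp only [Ty.nf, ih₁ hG, ih₂ hG, ih₃ hG]
  case nth =>
    intro _ i _ H ts us t u _ ht hu ih hG
    have := ih hG
    simp only [Ty.nf, Ty.con.injEq, true_and, Ty.nfs_eq_map] at this
    have := congrArg (fun l => l[i]?) this
    simpa [ht, hu] using this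
  case nthArrow =>
    intro _ i _ a₀ a₁ b₀ b₁ t u _ ht hu ih hG
    have := ih hG
    simp only [Ty.nf, Ty.arrow.injEq] at this
    rcases i with _ | _ | i <;> simp_all
  case nthQual =>
    intro _ i _ a₀ a₁ a₂ b₀ b₁ b₂ t u _ ht hu ih hG
    have := ih hG
    simp only [Ty.nf, Ty.qual.injEq] at this
    rcases i with _ | _ | _ | i <;> simp_all
  case inst =>
    intro _ _ a b t _ _ ih hG
    have := ih hG
    simp only [Ty.nf, upTy_var, Ty.all.injEq] at this
    exact Ty.nf_inst_congr hS hgood this t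
  -- A context of type variables has no coercion variable to refer to.
  case var =>
    intro G c a b _ hco hG
    exfalso
    rename_i hctx
    clear hctx
    induction hco with
    | tv _ ih => exact ih (by simpa using hG)
    | _ => simp at hG
  case axm =>
    intro G ξ Es i E σs qs hξ _ hE _ hσ _ hnc ih hG
    have hsc := hS.scoped hξ E (List.mem_of_getElem? hE)
    have hc := ih hG _ _ _ hsc.assumps rfl
    have hσ' : ∀ t ∈ σs, t.FamFree := fun t ht => (hσ t ht).2
    -- The axiom is instantiated at family-free types, which are their own normal forms; hence `Red`
    -- applies with the identity as `η`.
    have hid : (fun k => (ofList σs k).nf S Ty.var) = fun k => (ofList σs k).subst Ty.var :=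
      funext fun k => (ofList_famFree hσ' k).nf_eq _
    rw [hid] at hc
    have hr := Red.mk hξ hE hσ' hnc hc
    have hl := (famFreeHom_nf hS hgood Ty.var).map_substs hsc.lhs (ofList σs)
    rw [hid] at hl
    simp only [Ty.nf, Ty.nfs_eq_map]
    rw [hl, hr.evalFam_eq hS hgood]
    exact (famFreeHom_nf hS hgood Ty.var _ hsc.rhs_famFree _).symm
  case nil => intros; rfl
  case cons => intro _ _ _ _ _ _ _ _ _ ih₁ ih₂ hG; simp only [Ty.nfs, ih₁ hG, ih₂ hG]
  case rnil =>
    intro G _ _ χs₀ θ n _ hχ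
    cases χs₀ with
    | nil => exact .nil _
    | cons => simp [Assump.substs] at hχ
  case rcons =>
    intro G t g qs χ χs ht _ _ ih₁ ih₂ hG χs₀ θ n hsc hχ
    cases χs₀ with
    | nil => simp [Assump.substs] at hχ
    | cons χ₀ χs₀ =>
      simp only [Assump.substs, List.cons.injEq] at hχ
      obtain ⟨rfl, rfl⟩ := hχ
      refine .cons (u := t.nf S Ty.var) ?_ ?_
      · have h₁ := ih₁ hG
        simp only [Ty.nf, Ty.nfs_eq_map] at h₁
        rw [(famFreeHom_nf hS hgood Ty.var).map_substs fun t ht => (hsc.1 t ht).1] at h₁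
        rw [← h₁]
        -- The resolution is a proper type, so its normal form is not headed by a family. The
        -- application is therefore not stuck and must have evaluated.
        refine (evalFam_spec S _ _).resolve_right fun h => ?_
        exact ht.nf_ne_fam _ _ (h₁.symm.trans h)
      · rw [← comp_scons (fun t : Ty => t.nf S Ty.var)]
        exact ih₂ hG χs₀ (scons t θ) _ hsc.2 (by rw [Assump.substs_substs, upTy_scons])

end Normal

end CFC

-- Progress

open CFC in
theorem mainTheorem2 (C : CFC.Consts) (S : CFC.Sig)
    (hS : CFC.SigValid C S) (hgood : CFC.GoodSig S) (hC : CFC.ConstsValid C S)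
    (htotal : CFC.TotalFamilies C S)
    (e : CFC.Tm) (τ : CFC.Ty) (he : CFC.HasType C S [] e τ) :
    e.IsValue ∨ (∃ (v : CFC.Tm) (γ : CFC.Co), v.IsValue ∧ e = CFC.Tm.cast v γ) ∨
      ∃ e' : CFC.Tm, CFC.Step C S e e' := by
  have consistent : ∀ {g a b}, CoValid C S [] g a b → a.nf S Ty.var = b.nf S Ty.var :=
    fun h => h.nf_eq hS hgood (by simp)
  generalize hG : ([] : Ctx) = G at he
  induction he with
  | var _ hx => subst hG; cases hx
  | con => exact .inl (.con _)
  | lam => exact .inl (.lam _ _)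
  | tlam => exact .inl (.tlam _)
  | clam => exact .inl (.clam _ _ _)
  | app h₁ _ ih₁ _ =>
    subst hG
    refine .inr (.inr ?_)
    rcases ih₁ rfl with hv | ⟨v, γ, hv, rfl⟩ | ⟨e', hs⟩
    · cases hv <;> cases h₁
      exact ⟨_, .beta⟩
    · cases h₁ with
      | cast hv' hγ _ =>
        have := consistent hγ
        -- Types of values are headed by a constant, arrow, quantifier or qualification, and `Ty.nf`
        -- keeps these heads. Equality of normal forms leaves only the abstraction of an arrow type.
        cases hv <;> cases hv' <;> simp [Ty.nf] at this
        exact ⟨_, .push⟩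
    · exact ⟨_, .app hs⟩
  | tapp h₁ _ ih₁ =>
    subst hG
    refine .inr (.inr ?_)
    rcases ih₁ rfl with hv | ⟨v, γ, hv, rfl⟩ | ⟨e', hs⟩
    · cases hv <;> cases h₁
      exact ⟨_, .tbeta⟩
    · cases h₁ with
      | cast hv' hγ _ =>
        have := consistent hγ
        cases hv <;> cases hv' <;> simp [Ty.nf] at this
        exact ⟨_, .tpush⟩
    · exact ⟨_, .tapp hs⟩
  | capp h₁ _ ih₁ =>
    subst hG
    refine .inr (.inr ?_)
    rcases ih₁ rfl with hv | ⟨v, γ, hv, rfl⟩ | ⟨e', hs⟩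
    · cases hv <;> cases h₁
      exact ⟨_, .cbeta⟩
    · cases h₁ with
      | cast hv' hγ _ =>
        have := consistent hγ
        cases hv <;> cases hv' <;> simp [Ty.nf] at this
        exact ⟨_, .cpush⟩
    · exact ⟨_, .capp hs⟩
  | cast _ _ _ ih =>
    rcases ih hG with hv | ⟨v, γ, hv, rfl⟩ | ⟨e', hs⟩
    · exact .inr (.inl ⟨_, _, hv, rfl⟩)
    -- A twice coerced value is not a final form; its two coercions are composed.
    · exact .inr (.inr ⟨_, .trans hv⟩)
    · exact .inr (.inr ⟨_, .cast hs⟩)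
  | assume hF hargs _ _ =>
    subst hG
    -- The context is empty, so the arguments are closed types and the totality assumption supplies
    -- the resolution.
    obtain ⟨q, hq⟩ := htotal _ _ hF _ rfl hargs
    exact .inr (.inr ⟨_, .resolve ⟨hF, hargs, hq⟩⟩)
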